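/- **Conventions.** Let $L$ be a set of labels. An $L$-labelled graph is a directed graph whose edges carry labels in $L$ (loops, and parallel edges with different labels, are allowed; no properness of the labelling is required). Distances, degrees, edge sets, connectedness and components refer to its underlying undirected simple graph. A *graph sequence* is a sequence $(G_n)_{n\in\mathbb N}$ of finite connected labelled graphs of uniformly bounded degree with $|V(G_n)|\to\infty$. It is * an *expander* if there is $c>0$ with $h(G_n)>c$ for all $n$, where $h(G)=\min\{|\partial A|/|A| : A\subset V(G),\ 0<|A|\le |V(G)|/2\}$ and $\partial A$ is the set of edges with exactly one end point in $A$; * *hyperfinite* if for every $\varepsilon>0$ there are $K>0$ and $E_n\subset E(G_n)$ such that $\lim_n |E_n|/|V(G_n)|<\varepsilon$ and for all $n$ the connected components of $G_n\setminus E_n$ have at most $K$ vertices; * said to have *property A* if for every $\varepsilon>0$ there are $R>0$ and a map $x\mapsto \xi_x$ from $\mathcal G=\bigsqcup_n V(G_n)$ to $\ell^1(\mathcal G)$ with $\|\xi_x\|_1=1$, with $\xi_x$ supported in the ball of radius $R$ about $x$, and with $\|\xi_x-\xi_y\|_1<\varepsilon$ for every edge $(x,y)$. Let $\Gamma$ be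 a group with a finite generating set $S$. Its Cayley graph $\mathrm{Cay}(\Gamma,S)$ has an edge labelled $s$ from $x$ to $xs$ for all $x\in\Gamma$, $s\in S$. An $S$-labelled graph sequence $(G_n)$ is a *sofic approximation* of $\Gamma$ if for every $r\in\mathbb N$ the proportion of vertices $x$ of $G_n$ whose ball $B_r(G_n,x)$ is isomorphic, as a rooted labelled graph, to $B_r(\mathrm{Cay}(\Gamma,S),1)$ tends to $1$ as $n\to\infty$. $\Gamma$ is *amenable* if it satisfies Følner's condition. A *filtration* of $\Gamma$ is a descending sequence $N_0\ge N_1\ge\cdots$ of finite index normal subgroups with trivial intersection; for $N=N_k$ the graph $\mathrm{Cay}(\Gamma/N,\overline S)$, labelled by $S$, has an edge labelled $s$ from $x$ to $x\bar s$. **Theorem.** 1. Let $\Gamma$ be an infinite amenable group with a finite generating set $S$ and a filtration $(N_k)$. Then there exists an $S$-labelled expander. Moreover, let $(H_n)_{n\in\mathbb N}$ be any $S$-labelled expander. Then for every $n$ there is a $k$ with $|V(H_n)|/|\Gamma/N_k|<\frac1{n+1}$. For every choice of indices $k(n)$ with $|V(H_n)|/|\Gamma/N_{k(n)}|<\frac1{n+1}$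 for all $n$, and for every choice of vertices $p_n$ of $\mathrm{Cay}(\Gamma/N_{k(n)},\overline S)$ and $q_n$ of $H_n$, let $G_n'$ be the graph obtained from the disjoint union of $\mathrm{Cay}(\Gamma/N_{k(n)},\overline S)$ and $H_n$ by identifying $p_n$ with $q_n$. Then $(G_n')$ is a sofic approximation of $\Gamma$, it is hyperfinite, and it does not have property A. 2. There exist an infinite amenable group, a finite generating set of it and a filtration of it, so that part 1 applies. 3. Consequently amenability of a (residually finite, finitely generated) group $\Gamma$ does not imply that every sofic approximation of $\Gamma$ has property A. 4. Likewise, hyperfiniteness of a sofic approximation of a (residually finite, finitely generated) group does not imply that this sofic approximation has property A. -/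

import Mathlib

open Filter Topology

universe u v

/-- A directed graph on `V` whose edges carry labels in `L`: `G.Edge s x y` says that there is an
edge from `x` to `y` with label `s`. Loops and parallel edges with different labels are allowed. -/
structure LabelledGraph (L : Type*) (V : Type*) where
  Edge : L → V → V → Prop

namespace LabelledGraph

variable {L V W : Type*}

/-- The underlying undirected simple graph (forget directions, labels and loops). It carries the
graph metric, the degrees, the edges and the connected components. -/
def toSimpleGraph (G : LabelledGraph L V) : SimpleGraph V :=
  SimpleGraph.fromRel (fun x y => ∃ s, G.Edge s x y)

/-- The vertices of the closed ball of radius `r` about `x`. -/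
def ball (G : LabelledGraph L V) (x : V) (r : ℕ) : Set V :=
  {y | G.toSimpleGraph.edist x y ≤ r}

theorem mem_ball_self (G : LabelledGraph L V) (x : V) (r : ℕ) : x ∈ G.ball x r := by
  simp [ball]

/-- The balls `B_r(G, x)` and `B_r(H, y)` (with all labelled edges between their vertices) are
isomorphic as rooted labelled graphs. -/
def BallIso (G : LabelledGraph L V) (x : V) (H : LabelledGraph L W) (y : W) (r : ℕ) : Prop :=
  ∃ f : G.ball x r ≃ H.ball y r,
    f ⟨x, G.mem_ball_self x r⟩ = ⟨y, H.mem_ball_self y r⟩ ∧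
    ∀ (s : L) (a b : G.ball x r), G.Edge s a b ↔ H.Edge s (f a) (f b)

/-- The Cayley graph of `Γ` with respect to a family `ι : L → Γ`: an edge with label `s` from `x` to
`x * ι s` for all `x : Γ` and `s : L`. -/
def cayley {Γ : Type*} [Group Γ] (ι : L → Γ) : LabelledGraph L Γ where
  Edge s x y := x * ι s = y

/-- The inclusion of `W` into the one-point union of `V` and `W` along `p ∈ V` and `q ∈ W`, where
the vertex set of the union is modelled as `V ⊔ (W \ {q})`; the point `q` is sent to `p`. -/
noncomputable def wedgeRight (p : V) (q : W) (w : W) : V ⊕ {w : W // w ≠ q} :=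
  open Classical in if h : w = q then Sum.inl p else Sum.inr ⟨w, h⟩

/-- The graph obtained from the disjoint union of `G` and `H` by identifying the vertex `p` of `G`
with the vertex `q` of `H`. Its labelled edges are those of `G` and those of `H`. -/
noncomputable def glue (G : LabelledGraph L V) (H : LabelledGraph L W) (p : V) (q : W) :
    LabelledGraph L (V ⊕ {w : W // w ≠ q}) where
  Edge s a b :=
    (∃ x y : V, G.Edge s x y ∧ a = Sum.inl x ∧ b = Sum.inl y) ∨
    (∃ x y : W, H.Edge s x y ∧ a = wedgeRight p q x ∧ b = wedgeRight p q y)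

end LabelledGraph

/-- The Cheeger constant of a finite graph: the minimum of `|∂A| / |A|` over the vertex sets `A` with
`0 < |A| ≤ |V| / 2`, where `∂A` is the set of edges with exactly one end point in `A`. -/
noncomputable def cheegerConstant {V : Type*} (G : SimpleGraph V) : ℝ :=
  sInf {h : ℝ | ∃ A : Set V, 0 < A.ncard ∧ (A.ncard : ℝ) ≤ (Nat.card V : ℝ) / 2 ∧
    h = ({e ∈ G.edgeSet | ∃ x ∈ A, ∃ y ∉ A, e = s(x, y)}.ncard : ℝ) / (A.ncard : ℝ)}

section Sequences

variable {L : Type*} {V : ℕ → Type*}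

/-- A graph sequence: finite connected graphs of uniformly bounded degree whose numbers of vertices
tend to infinity. -/
structure IsGraphSequence (G : ∀ n, LabelledGraph L (V n)) : Prop where
  finite : ∀ n, Finite (V n)
  connected : ∀ n, (G n).toSimpleGraph.Connected
  bounded_degree : ∃ d : ℕ, ∀ n (x : V n), ((G n).toSimpleGraph.neighborSet x).encard ≤ d
  tendsto_card : Tendsto (fun n => Nat.card (V n)) atTop atTop

/-- An expander: a graph sequence whose Cheeger constants are bounded away from zero. -/
def IsExpander (G : ∀ n, LabelledGraph L (V n)) : Prop :=
  IsGraphSequence G ∧ ∃ c : ℝ, 0 < c ∧ ∀ n, c < cheegerConstant (G n).toSimpleGraph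

/-- The disjoint union of the underlying simple graphs of a sequence. Vertices of different members
of the sequence have distance `⊤`. -/
def unionGraph (G : ∀ n, LabelledGraph L (V n)) : SimpleGraph (Σ n, V n) where
  Adj a b := ∃ (n : ℕ) (x y : V n), (G n).toSimpleGraph.Adj x y ∧ a = ⟨n, x⟩ ∧ b = ⟨n, y⟩
  symm := ⟨by
    rintro a b ⟨n, x, y, h, rfl, rfl⟩
    exact ⟨n, y, x, h.symm, rfl, rfl⟩⟩
  loopless := ⟨by
    rintro a ⟨n, x, y, h, rfl, h'⟩
    obtain rfl : x = y := eq_of_heq (Sigma.mk.inj h').2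
    exact h.ne rfl⟩

/-- Property A: for every `ε > 0` there are `R > 0` and a map `ξ` from the disjoint union of the
graphs to its `ℓ¹`-space, such that every `ξ x` has norm one and is supported in the ball of radius
`R` about `x`, and `‖ξ x - ξ y‖₁ < ε` for every edge `(x, y)`. -/
def HasPropertyA (G : ∀ n, LabelledGraph L (V n)) : Prop :=
  ∀ ε : ℝ, 0 < ε → ∃ R : ℕ, 0 < R ∧ ∃ ξ : (Σ n, V n) → lp (fun _ : (Σ n, V n) => ℝ) 1,
    (∀ x, ‖ξ x‖ = 1) ∧
    (∀ x y, ξ x y ≠ 0 → (unionGraph G).edist x y ≤ R) ∧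
    (∀ x y, (unionGraph G).Adj x y → ‖ξ x - ξ y‖ < ε)

/-- Hyperfiniteness: for every `ε > 0` there are `K > 0` and edge sets `E n` such that
`lim |E n| / |V n| < ε` and, after deletion of `E n`, every connected component of the `n`-th graph
has at most `K` vertices. -/
def IsHyperfinite (G : ∀ n, LabelledGraph L (V n)) : Prop :=
  ∀ ε : ℝ, 0 < ε → ∃ K : ℕ, 0 < K ∧ ∃ E : ∀ n, Set (Sym2 (V n)),
    (∀ n, E n ⊆ (G n).toSimpleGraph.edgeSet) ∧
    (∃ l : ℝ, l < ε ∧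
      Tendsto (fun n => ((E n).ncard : ℝ) / (Nat.card (V n) : ℝ)) atTop (𝓝 l)) ∧
    (∀ n (C : ((G n).toSimpleGraph.deleteEdges (E n)).ConnectedComponent), C.supp.encard ≤ K)

/-- A sofic approximation of `Γ` (with respect to the family of generators `ι : L → Γ`): a labelled
graph sequence which converges to the Cayley graph of `Γ` in the Benjamini-Schramm sense, i.e. for
every `r` the proportion of the vertices of the `n`-th graph whose `r`-ball is isomorphic, as a
rooted labelled graph, to the `r`-ball about `1` in the Cayley graph tends to `1`. -/
def IsSoficApproximation {Γ : Type*} [Group Γ] (ι : L → Γ)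
    (G : ∀ n, LabelledGraph L (V n)) : Prop :=
  IsGraphSequence G ∧ ∀ r : ℕ, Tendsto
    (fun n => ({x : V n | (G n).BallIso x (LabelledGraph.cayley ι) 1 r}.ncard : ℝ) /
      (Nat.card (V n) : ℝ)) atTop (𝓝 1)

end Sequences

/-- Amenability of a discrete group (Følner's condition). -/
def IsAmenableGroup (Γ : Type*) [Group Γ] : Prop :=
  open Classical in
  ∀ (K : Finset Γ) (ε : ℝ), 0 < ε → ∃ F : Finset Γ, F.Nonempty ∧
    ∀ g ∈ K, ((symmDiff (F.image (fun x => g * x)) F).card : ℝ) ≤ ε * (F.card : ℝ)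

/-- A filtration: a descending sequence of normal subgroups of finite index with trivial
intersection. -/
def IsGroupFiltration {Γ : Type*} [Group Γ] (N : ℕ → FiniteIndexNormalSubgroup Γ) : Prop :=
  Antitone N ∧ ⨅ k, (N k).toSubgroup = ⊥

/-- The member `Cay(Γ / N, S̄)` of a box space. -/
def quotientCayley {Γ : Type*} [Group Γ] (S : Finset Γ) (N : FiniteIndexNormalSubgroup Γ) :
    LabelledGraph S (Γ ⧸ N.toSubgroup) :=
  LabelledGraph.cayley (fun s : S => (QuotientGroup.mk (s : Γ) : Γ ⧸ N.toSubgroup))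

/-! Soficity and hyperfiniteness ignore a vanishing proportion of the vertices, whereas property A
is uniform over all of them. A small expander glued to a huge quotient Cayley graph is therefore
invisible to the first two and fatal to the third.

Soficity (`isSoficApproximation_glue`): the only bad vertices are those of the expander and those
near the gluing point, a boundedly large ball. At every other vertex the ball is that of the
quotient, and it agrees with the ball of the group once the normal subgroup is deep enough in the
filtration.

Hyperfiniteness (`isHyperfinite_glue`): all edges of the expander may be deleted. In the quotient, a
Følner set E gives cells (`exists_cells`): in a random total order each x selects the least point of
xE. Cells have at most |E| points, and neighbours x, xs disagree only if the least point of xE ∪ xsE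
lies in the symmetric difference, which is unlikely.

Failure of property A (`not_hasPropertyA_of_isExpander`): for fixed z the function x ↦ |ξ_x(z)| on
the expander lives in an R-ball, hence on at most half of a large member. The coarea inequality
`mul_sum_le_sum_adj_abs_sub` bounds its sum by its variation along edges; summing over z contradicts
the smallness of ‖ξ_x - ξ_y‖.

Expanders come from a union bound over 23 random permutations (`exists_perms_expanding`). The
integers with the subgroups generated by powers of 2 supply the concrete instance. -/

namespace SimpleGraph

/-! ### Balls, connectedness and the discrete coarea inequality -/

variable {V : Type*} {G : SimpleGraph V}

/-- Splitting off the last edge of a shortest walk lets every later statement about balls be proved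
by induction on the radius, without handling walks. -/
theorem edist_le_succ_iff {x y : V} {r : ℕ} :
    G.edist x y ≤ (r + 1 : ℕ) ↔ G.edist x y ≤ r ∨ ∃ z, G.edist x z ≤ r ∧ G.Adj z y := by
  constructor
  · intro h
    obtain ⟨w, hw⟩ := G.exists_walk_of_edist_ne_top
      (ne_top_of_le_ne_top (ENat.natCast_ne_top _) h)
    rw [← hw] at h
    have hl : w.reverse.length ≤ r + 1 := by
      rw [Walk.length_reverse]
      exact_mod_cast h
    cases hq : w.reverse with
    | nil => left; simp
    | cons a q =>
      right
      refine ⟨_, (G.edist_le q.reverse).trans ?_, a.symm⟩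
      rw [hq] at hl
      simp only [Walk.length_cons, Walk.length_reverse] at hl ⊢
      exact_mod_cast (by omega : q.length ≤ r)
  · rintro (h | ⟨z, hz, ha⟩)
    · exact h.trans (by exact_mod_cast Nat.le_succ r)
    · calc G.edist x y ≤ G.edist x z + G.edist z y := G.edist_triangle
        _ ≤ r + 1 := add_le_add hz (edist_eq_one_iff_adj.2 ha).le
        _ = (r + 1 : ℕ) := by push_cast; rfl

/-- In a graph of bounded degree, the size of balls is bounded in terms of the radius. -/
theorem exists_finset_ball_subset {d : ℕ} (hd : ∀ x, (G.neighborSet x).encard ≤ d) (x : V)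
    (r : ℕ) : ∃ t : Finset V, (∀ y, G.edist x y ≤ r → y ∈ t) ∧ t.card ≤ (d + 1) ^ r := by
  classical
  induction r with
  | zero =>
    refine ⟨{x}, fun y hy => ?_, by simp⟩
    rw [Finset.mem_singleton, ← edist_eq_zero_iff (G := G), SimpleGraph.edist_comm]
    simpa using hy
  | succ r ih =>
    obtain ⟨t, ht, htc⟩ := ih
    have hfin : ∀ z, (G.neighborSet z).Finite := fun z =>
      Set.finite_of_encard_le_coe (hd z)
    refine ⟨t.biUnion fun z => insert z (hfin z).toFinset, fun y hy => ?_, ?_⟩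
    · rw [Finset.mem_biUnion]
      rcases edist_le_succ_iff.1 hy with h | ⟨z, hz, ha⟩
      · exact ⟨y, ht y h, Finset.mem_insert_self _ _⟩
      · exact ⟨z, ht z hz, Finset.mem_insert_of_mem (by simpa using ha)⟩
    · refine (Finset.card_biUnion_le_card_mul _ _ (d + 1) fun z _ => ?_).trans ?_
      · refine (Finset.card_insert_le _ _).trans (Nat.succ_le_succ ?_)
        have := hd z
        rw [(hfin z).encard_eq_coe_toFinset_card] at this
        exact_mod_cast this
      · rw [pow_succ]
        exact Nat.mul_le_mul_right _ htc

/-- If every nonempty set of at most half of the vertices has an outgoing edge, then the graph is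
connected. -/
theorem connected_of_exists_adj [Fintype V] [Nonempty V]
    (h : ∀ A : Finset V, A.Nonempty → 2 * A.card ≤ Fintype.card V →
      ∃ x ∈ A, ∃ y ∉ A, G.Adj x y) : G.Connected := by
  classical
  refine (connected_iff G).2 ⟨fun x y => ?_, inferInstance⟩
  by_contra hxy
  set A : Finset V := Finset.univ.filter (fun z => G.Reachable x z)
  have hA : x ∈ A := by simp [A]
  have hy : y ∈ Aᶜ := by simp [A, hxy]
  have hc : A.card + Aᶜ.card = Fintype.card V := A.card_add_card_compl
  rcases le_total (2 * A.card) (Fintype.card V) with h1 | h1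
  · obtain ⟨a, ha, b, hb, hab⟩ := h A ⟨x, hA⟩ h1
    simp only [A, Finset.mem_filter, Finset.mem_univ, true_and] at ha hb
    exact hb (ha.trans hab.reachable)
  · obtain ⟨a, ha, b, hb, hab⟩ := h Aᶜ ⟨y, hy⟩ (by omega)
    simp only [A, Finset.mem_filter, Finset.mem_univ, true_and, Finset.mem_compl,
      not_not] at ha hb
    exact ha (hb.trans hab.symm.reachable)

open Classical in
/-- A discrete coarea inequality: isoperimetry for sets gives an `ℓ¹`-Poincaré inequality for
nonnegative functions of small support. -/
theorem mul_sum_le_sum_adj_abs_sub [Fintype V] {c : ℝ}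
    (hc : ∀ A : Finset V, A.Nonempty → 2 * A.card ≤ Fintype.card V →
      c * A.card ≤ (Finset.univ.filter
        fun p : V × V => p.1 ∈ A ∧ p.2 ∉ A ∧ G.Adj p.1 p.2).card)
    (f : V → ℝ) (hf : ∀ x, 0 ≤ f x)
    (hs : 2 * (Finset.univ.filter fun x => f x ≠ 0).card ≤ Fintype.card V) :
    c * ∑ x, f x ≤ ∑ p : V × V with G.Adj p.1 p.2, |f p.1 - f p.2| := by
  generalize hk : (Finset.univ.filter fun x => f x ≠ 0).card = k at hs
  induction k using Nat.strong_induction_on generalizing f with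
  | _ k ih =>
  set A := Finset.univ.filter fun x => f x ≠ 0 with hA
  have memA : ∀ x, x ∈ A ↔ f x ≠ 0 := fun x => by simp [hA]
  rcases A.eq_empty_or_nonempty with h0 | h0
  · have hz : ∀ x, f x = 0 := fun x => by
      by_contra hx
      have := (memA x).2 hx
      simp [h0] at this
    simp [hz]
  obtain ⟨a, haA, hamin⟩ := A.exists_min_image f h0
  set m := f a
  have hm : 0 < m := lt_of_le_of_ne (hf a) (Ne.symm ((memA a).1 haA))
  -- Peel off the lowest level: f = g + m·1_A, where m is the least nonzero value of f, so g is
  -- still nonnegative and has strictly smaller support.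
  set g : V → ℝ := fun x => if x ∈ A then f x - m else 0 with hg
  have hfg : ∀ x, f x = g x + m * (if x ∈ A then 1 else 0) := fun x => by
    by_cases hx : x ∈ A
    · simp [hg, hx]
    · have := (memA x).not.1 hx
      push Not at this
      simp [hg, hx, this]
  have hg0 : ∀ x, 0 ≤ g x := fun x => by
    by_cases hx : x ∈ A
    · simpa [hg, hx] using hamin x hx
    · simp [hg, hx]
  have hgs : (Finset.univ.filter fun x => g x ≠ 0).card < k := by
    rw [← hk]
    apply Finset.card_lt_card
    refine (Finset.ssubset_iff_of_subset fun x hx => ?_).2 ⟨a, haA, by simp [hg, m]⟩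
    by_contra hxA
    simp [hg, hxA] at hx
  have h1 := ih _ hgs g hg0 rfl (by omega)
  -- No cancellation occurs: g is nonnegative and vanishes off A, so the differences of g and of 1_A
  -- never have opposite signs.
  have habs : ∀ x y, |f x - f y| = |g x - g y| +
      m * |(if x ∈ A then (1 : ℝ) else 0) - (if y ∈ A then 1 else 0)| := fun x y => by
    have hx0 := hg0 x
    have hy0 := hg0 y
    rw [hfg x, hfg y]
    by_cases hx : x ∈ A <;> by_cases hy : y ∈ A
    · simp [hx, hy]
    · have : g y = 0 := by simp [hg, hy]
      simp only [hx, hy, if_true, if_false, this]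
      rw [abs_of_nonneg (by nlinarith), abs_of_nonneg (by nlinarith)]
      simp
    · have : g x = 0 := by simp [hg, hx]
      simp only [hx, hy, if_true, if_false, this]
      rw [abs_of_nonpos (by nlinarith), abs_of_nonpos (by nlinarith)]
      ring
    · simp [hx, hy]
  have h2 : c * A.card ≤ ∑ p : V × V with G.Adj p.1 p.2,
      |(if p.1 ∈ A then (1 : ℝ) else 0) - (if p.2 ∈ A then 1 else 0)| := by
    refine (hc A h0 (by omega)).trans ?_
    rw [Finset.card_eq_sum_ones, Nat.cast_sum]
    refine (Finset.sum_le_sum fun p hp => ?_).trans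
      (Finset.sum_le_sum_of_subset_of_nonneg
        (s := Finset.univ.filter fun p : V × V => p.1 ∈ A ∧ p.2 ∉ A ∧ G.Adj p.1 p.2)
        (fun p hp => ?_) fun _ _ _ => abs_nonneg _)
    · simp only [Finset.mem_filter, Finset.mem_univ, true_and] at hp
      simp [hp.1, hp.2.1]
    · simp only [Finset.mem_filter, Finset.mem_univ, true_and] at hp ⊢
      exact hp.2.2
  have h3 : ∑ x, f x = ∑ x, g x + m * A.card := by
    simp_rw [hfg]
    rw [Finset.sum_add_distrib, ← Finset.mul_sum]
    simp
  simp_rw [habs]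
  rw [Finset.sum_add_distrib, ← Finset.mul_sum, h3]
  nlinarith [mul_le_mul_of_nonneg_left h2 hm.le]

end SimpleGraph

-- Puts the Cheeger bound into the form required by the coarea inequality. Each boundary edge comes
-- from an ordered pair leaving A, so passing from edges to pairs loses nothing.
open Classical in
theorem mul_card_le_of_lt_cheegerConstant {V : Type*} [Fintype V] {G : SimpleGraph V} {c : ℝ}
    (h : c < cheegerConstant G) (A : Finset V) (hA : A.Nonempty)
    (hA2 : 2 * A.card ≤ Fintype.card V) :
    c * A.card ≤ (Finset.univ.filter
      fun p : V × V => p.1 ∈ A ∧ p.2 ∉ A ∧ G.Adj p.1 p.2).card := by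
  have hpos : (0 : ℝ) < A.card := by exact_mod_cast hA.card_pos
  have hle : cheegerConstant G ≤
      ({e ∈ G.edgeSet | ∃ x ∈ (A : Set V), ∃ y ∉ (A : Set V), e = s(x, y)}.ncard : ℝ) /
        ((A : Set V).ncard : ℝ) := by
    refine csInf_le ⟨0, ?_⟩ ⟨A, ?_, ?_, rfl⟩
    · rintro _ ⟨B, -, -, rfl⟩
      positivity
    · rw [Set.ncard_coe_finset]
      exact hA.card_pos
    · rw [Set.ncard_coe_finset, Nat.card_eq_fintype_card, le_div_iff₀ two_pos, mul_comm]
      exact_mod_cast hA2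
  rw [Set.ncard_coe_finset] at hle
  refine ((le_div_iff₀ hpos).1 (h.le.trans hle)).trans ?_
  rw [← Set.ncard_coe_finset]
  refine Nat.cast_le.2 ?_
  refine (Set.ncard_le_ncard ?_ (Set.toFinite _)).trans
    (Set.ncard_image_le (f := fun p : V × V => s(p.1, p.2)) (Set.toFinite _))
  rintro e ⟨he, x, hx, y, hy, rfl⟩
  exact ⟨(x, y), by simpa using ⟨hx, hy, he⟩, rfl⟩

/-! ### Random permutations and the existence of expanders -/

section ExpanderExistence

open Classical in
/-- The proportion of the permutations which map `A` into `B` is at most `(|B| / |V|) ^ |A|`. -/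
theorem card_perm_mapsTo_le {V : Type*} [Fintype V] (A B : Finset V) :
    ((Finset.univ.filter fun σ : Equiv.Perm V => ∀ x ∈ A, σ x ∈ B).card : ℝ) ≤
      (Fintype.card V).factorial * ((B.card : ℝ) / Fintype.card V) ^ A.card := by
  induction A using Finset.induction_on with
  | empty => simp [Fintype.card_perm]
  | insert x A hx ih =>
    set X := Finset.univ.filter fun σ : Equiv.Perm V => ∀ x ∈ A, σ x ∈ B with hX
    set n := Fintype.card V
    have memX : ∀ σ, σ ∈ X ↔ ∀ z ∈ A, σ z ∈ B := fun σ => by simp [hX]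
    have hY : (Finset.univ.filter fun σ : Equiv.Perm V => ∀ z ∈ insert x A, σ z ∈ B) =
        X.filter (fun σ => σ x ∈ B) := by
      ext σ
      simp only [Finset.mem_filter, Finset.mem_univ, true_and, Finset.forall_mem_insert, hX]
      tauto
    -- Composing with a transposition of points outside A preserves X, so all points outside A are
    -- equally likely to land in B.
    have hswap : ∀ y ∈ Aᶜ, (X.filter (fun σ => σ y ∈ B)).card =
        (X.filter (fun σ => σ x ∈ B)).card := fun y hy => by
      have key : ∀ σ ∈ X, σ * Equiv.swap x y ∈ X := fun σ hσ => by
        rw [memX] at hσ ⊢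
        intro z hz
        have hzx : z ≠ x := fun h => hx (h ▸ hz)
        have hzy : z ≠ y := fun h => (Finset.mem_compl.1 hy) (h ▸ hz)
        rw [Equiv.Perm.mul_apply, Equiv.swap_apply_of_ne_of_ne hzx hzy]
        exact hσ z hz
      refine Finset.card_bij' (fun σ _ => σ * Equiv.swap x y) (fun σ _ => σ * Equiv.swap x y)
        (fun σ hσ => ?_) (fun σ hσ => ?_) (fun σ _ => ?_) (fun σ _ => ?_)
      · rw [Finset.mem_filter] at hσ ⊢
        exact ⟨key σ hσ.1, by simpa using hσ.2⟩
      · rw [Finset.mem_filter] at hσ ⊢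
        exact ⟨key σ hσ.1, by simpa using hσ.2⟩
      · simp [mul_assoc]
      · simp [mul_assoc]
    have hcount : ∀ σ ∈ X, (Aᶜ.filter fun y => σ y ∈ B).card + A.card = B.card := fun σ hσ => by
      rw [← Finset.card_union_of_disjoint]
      · refine Finset.card_bij (fun y _ => σ y) (fun y hy => ?_) (fun y _ z _ h => σ.injective h)
          fun z hz => ⟨σ.symm z, ?_, by simp⟩
        · rcases Finset.mem_union.1 hy with h | h
          · exact (Finset.mem_filter.1 h).2
          · exact (memX σ).1 hσ y h
        · by_cases h : σ.symm z ∈ A <;> simp [h, hz]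
      · exact Finset.disjoint_left.2 fun y hy hyA =>
          Finset.mem_compl.1 (Finset.mem_filter.1 hy).1 hyA
    have hdouble := Finset.sum_card_bipartiteAbove_eq_sum_card_bipartiteBelow
      (s := Aᶜ) (t := X) (fun y σ => σ y ∈ B)
    simp only [Finset.bipartiteAbove, Finset.bipartiteBelow] at hdouble
    rw [Finset.sum_congr rfl hswap, Finset.sum_const, smul_eq_mul] at hdouble
    -- Given that A is mapped into B, the point x lands in B with probability (|B| - |A|)/(n - |A|),
    -- which is at most |B|/n.
    have hd : ((n : ℝ) - A.card) * (X.filter (fun σ => σ x ∈ B)).card =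
        X.card * ((B.card : ℝ) - A.card) := by
      have h1 : ((Aᶜ.card : ℕ) : ℝ) = (n : ℝ) - A.card := by
        rw [eq_sub_iff_add_eq]
        have := A.card_add_card_compl
        norm_cast
        omega
      have h2 : (((∑ σ ∈ X, (Aᶜ.filter fun y => σ y ∈ B).card) : ℕ) : ℝ) =
          X.card * ((B.card : ℝ) - A.card) := by
        rw [Nat.cast_sum, ← nsmul_eq_mul, ← Finset.sum_const]
        refine Finset.sum_congr rfl fun σ hσ => ?_
        rw [eq_sub_iff_add_eq]
        exact_mod_cast hcount σ hσ
      rw [← h1, ← h2, ← hdouble]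
      push_cast
      rfl
    have hAn : (A.card : ℝ) < n := by
      have : A.card < n := Finset.card_lt_univ_of_notMem hx
      exact_mod_cast this
    have hBn : (B.card : ℝ) ≤ n := by exact_mod_cast B.card_le_univ
    have hn : (0 : ℝ) < n := lt_of_le_of_lt (Nat.cast_nonneg _) hAn
    have hYX : ((X.filter (fun σ => σ x ∈ B)).card : ℝ) ≤ X.card * ((B.card : ℝ) / n) := by
      rw [← mul_div_assoc, le_div_iff₀ hn]
      refine le_of_mul_le_mul_left ?_ (sub_pos.2 hAn)
      have h : ((B.card : ℝ) - A.card) * n ≤ (n - A.card) * B.card := by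
        nlinarith [(Nat.cast_nonneg A.card : (0 : ℝ) ≤ A.card)]
      calc ((n : ℝ) - A.card) * ((X.filter (fun σ => σ x ∈ B)).card * n)
          = X.card * (((B.card : ℝ) - A.card) * n) := by rw [← mul_assoc, hd, mul_assoc]
        _ ≤ X.card * ((n - A.card) * B.card) := mul_le_mul_of_nonneg_left h (Nat.cast_nonneg _)
        _ = _ := by ring
    rw [hY, Finset.card_insert_of_notMem hx, pow_succ, ← mul_assoc]
    exact hYX.trans (mul_le_mul_of_nonneg_right ih (by positivity))

/-- Combines n.choose a ≤ n^a/a! with a^a/a! ≤ e^a < 3^a. -/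
theorem Nat.choose_le_three_mul_div_pow (n : ℕ) {a : ℕ} (ha : 0 < a) :
    (n.choose a : ℝ) ≤ (3 * n / a) ^ a := by
  have ha' : (0 : ℝ) < a := by exact_mod_cast ha
  have h2 : (a : ℝ) ^ a / a.factorial ≤ 3 ^ a := by
    refine (Real.pow_div_factorial_le_exp a ha'.le a).trans ?_
    rw [show (a : ℝ) = a * 1 from (mul_one _).symm, Real.exp_nat_mul]
    exact pow_le_pow_left₀ (Real.exp_pos _).le Real.exp_one_lt_three.le _
  have hf : (0 : ℝ) < a.factorial := by exact_mod_cast a.factorial_pos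
  refine (Nat.choose_le_pow_div a n).trans ?_
  rw [div_pow, mul_pow, div_le_div_iff₀ hf (by positivity)]
  rw [div_le_iff₀ hf] at h2
  nlinarith [mul_le_mul_of_nonneg_left h2 (by positivity : (0 : ℝ) ≤ (n : ℝ) ^ a)]

/-- The contribution of all pairs (A, B) with |A| = a to the union bound. The binomials cost at most
(3n/a)^(3a), while 23 permutations gain (3a/2n)^(23a). As a/n ≤ 1/2, the product is at most
(27·(3/2)^23/2^20)^a, with base about 0.29. -/
theorem choose_mul_choose_mul_pow_le {n a : ℕ} (ha : 0 < a) (han : 2 * a ≤ n) :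
    (n.choose a : ℝ) * n.choose (3 * a / 2) * (((3 * a / 2 : ℕ) : ℝ) / n) ^ (23 * a) ≤
      (1 / 2) ^ a := by
  set b := 3 * a / 2 with hb
  have hab : a ≤ b := by omega
  have hb2 : b ≤ 2 * a := by omega
  have hb3 : 2 * b ≤ 3 * a := by omega
  have ha' : (0 : ℝ) < a := by exact_mod_cast ha
  have hb' : (0 : ℝ) < b := by exact_mod_cast (by omega : 0 < b)
  have hn' : (0 : ℝ) < n := by exact_mod_cast (by omega : 0 < n)
  have han' : 2 * (a : ℝ) ≤ n := by exact_mod_cast han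
  have hab' : (a : ℝ) ≤ b := by exact_mod_cast hab
  have hb3' : 2 * (b : ℝ) ≤ 3 * a := by exact_mod_cast hb3
  have h1 := Nat.choose_le_three_mul_div_pow n ha
  have h2 : (n.choose b : ℝ) ≤ (3 * n / a) ^ (2 * a) := by
    refine (Nat.choose_le_three_mul_div_pow n (by omega : 0 < b)).trans ?_
    refine (pow_le_pow_left₀ (by positivity)
      (div_le_div_of_nonneg_left (by positivity) ha' hab') b).trans ?_
    refine pow_le_pow_right₀ ?_ hb2
    rw [le_div_iff₀ ha']
    linarith
  have h3 : (b : ℝ) / n ≤ 3 / 2 * (a / n) := by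
    rw [← mul_div_assoc]
    exact div_le_div_of_nonneg_right (by linarith) hn'.le
  calc (n.choose a : ℝ) * n.choose b * ((b : ℝ) / n) ^ (23 * a)
      ≤ (3 * n / a) ^ a * (3 * n / a) ^ (2 * a) * (3 / 2 * (a / n)) ^ (23 * a) := by gcongr
    _ = ((3 * n / a) ^ 3 * (3 / 2 * (a / n)) ^ 23) ^ a := by
        rw [mul_pow _ _ a, ← pow_mul, ← pow_mul, ← pow_add]
        congr 2
        ring
    _ ≤ (1 / 2) ^ a := by
        refine pow_le_pow_left₀ (by positivity) ?_ a
        have hy : (a : ℝ) / n ≤ 1 / 2 := by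
          rw [div_le_div_iff₀ hn' two_pos]
          linarith
        have : ((3 * n / a : ℝ)) ^ 3 * (3 / 2 * (a / n)) ^ 23 =
            27 * (3 / 2) ^ 23 * ((a : ℝ) / n) ^ 20 := by
          field_simp
          ring
        rw [this]
        calc (27 : ℝ) * (3 / 2) ^ 23 * ((a : ℝ) / n) ^ 20
            ≤ 27 * (3 / 2) ^ 23 * (1 / 2) ^ 20 := by gcongr
          _ ≤ 1 / 2 := by norm_num

open Classical in
/-- There are 23 permutations of a finite set such that no set `A` of at most half of the points is
mapped by all of them into a set of size `⌊3 |A| / 2⌋`. -/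
theorem exists_perms_expanding (V : Type*) [Fintype V] :
    ∃ π : Fin 23 → Equiv.Perm V, ∀ A B : Finset V, A.Nonempty → 2 * A.card ≤ Fintype.card V →
      B.card = 3 * A.card / 2 → ∃ i, ∃ x ∈ A, π i x ∉ B := by
  by_contra! hcon
  set n := Fintype.card V
  let X : Finset V → Finset V → Finset (Equiv.Perm V) := fun A B =>
    Finset.univ.filter fun σ : Equiv.Perm V => ∀ x ∈ A, σ x ∈ B
  -- If every 23-tuple failed, the tuples would be covered by those mapping some A of size j + 1
  -- into some B of size ⌊3(j + 1)/2⌋.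
  have hcover : (Finset.univ : Finset (Fin 23 → Equiv.Perm V)) ⊆
      (Finset.range (n / 2)).biUnion fun j =>
        (Finset.powersetCard (j + 1) Finset.univ).biUnion fun A =>
          (Finset.powersetCard (3 * (j + 1) / 2) Finset.univ).biUnion fun B =>
            Fintype.piFinset fun _ => X A B := by
    intro π _
    obtain ⟨A, B, hA, hAn, hB, h⟩ := hcon π
    have := hA.card_pos
    simp only [Finset.mem_biUnion]
    refine ⟨A.card - 1, Finset.mem_range.2 (by omega), A, ?_, B, ?_, ?_⟩
    · rw [Finset.mem_powersetCard_univ]; omega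
    · rw [Finset.mem_powersetCard_univ, hB]; congr 2; omega
    · rw [Fintype.mem_piFinset]
      intro i
      simpa [X] using h i
  have hle := Finset.card_le_card hcover
  rw [Finset.card_univ, Fintype.card_fun, Fintype.card_perm, Fintype.card_fin] at hle
  set N : ℝ := (n.factorial : ℝ) ^ 23 with hN
  have hNpos : 0 < N := by positivity
  have hbound : N ≤ ∑ j ∈ Finset.range (n / 2), N * (1 / 2) ^ (j + 1) := by
    calc N ≤ (((Finset.range (n / 2)).biUnion fun j =>
          (Finset.powersetCard (j + 1) Finset.univ).biUnion fun A =>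
            (Finset.powersetCard (3 * (j + 1) / 2) Finset.univ).biUnion fun B =>
              Fintype.piFinset fun _ : Fin 23 => X A B).card : ℝ) := by
          rw [hN]
          exact_mod_cast hle
      _ ≤ _ := by
          refine (Nat.cast_le.2 Finset.card_biUnion_le).trans ?_
          rw [Nat.cast_sum]
          refine Finset.sum_le_sum fun j hj => ?_
          refine (Nat.cast_le.2 Finset.card_biUnion_le).trans ?_
          rw [Nat.cast_sum]
          have hjn : 2 * (j + 1) ≤ n := by
            have := Finset.mem_range.1 hj
            omega
          calc _ ≤ ∑ A ∈ Finset.powersetCard (j + 1) (Finset.univ : Finset V),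
                  (n.choose (3 * (j + 1) / 2) : ℝ) *
                    (N * (((3 * (j + 1) / 2 : ℕ) : ℝ) / n) ^ (23 * (j + 1))) := by
                refine Finset.sum_le_sum fun A hA => ?_
                refine (Nat.cast_le.2 Finset.card_biUnion_le).trans ?_
                rw [Nat.cast_sum]
                refine (Finset.sum_le_card_nsmul _ _
                  (N * (((3 * (j + 1) / 2 : ℕ) : ℝ) / n) ^ (23 * (j + 1))) fun B hB => ?_).trans ?_
                · rw [Fintype.card_piFinset_const, Nat.cast_pow]
                  rw [Finset.mem_powersetCard_univ] at hA hB
                  have := card_perm_mapsTo_le A B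
                  rw [hA, hB] at this
                  refine (pow_le_pow_left₀ (Nat.cast_nonneg _) this _).trans (le_of_eq ?_)
                  rw [mul_pow, ← pow_mul, mul_comm (j + 1)]
                · rw [Finset.card_powersetCard, nsmul_eq_mul, Finset.card_univ]
            _ = N * ((n.choose (j + 1) : ℝ) * n.choose (3 * (j + 1) / 2) *
                    (((3 * (j + 1) / 2 : ℕ) : ℝ) / n) ^ (23 * (j + 1))) := by
                rw [Finset.sum_const, Finset.card_powersetCard, nsmul_eq_mul, Finset.card_univ]
                ring
            _ ≤ _ := mul_le_mul_of_nonneg_left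
                (choose_mul_choose_mul_pow_le (Nat.succ_pos j) hjn) hNpos.le
  have hgeom : ∀ m : ℕ, ∑ j ∈ Finset.range m, N * (1 / 2) ^ (j + 1) = N * (1 - (1 / 2) ^ m) := by
    intro m
    induction m with
    | zero => simp
    | succ m ih => rw [Finset.sum_range_succ, ih]; ring
  -- The finite geometric sum is strictly less than 1, so some tuple is not covered.
  rw [hgeom] at hbound
  have : (0 : ℝ) < (1 / 2) ^ (n / 2) := by positivity
  nlinarith [mul_pos hNpos this]

open Classical in
/-- Labelled expanders exist for every nonempty set of labels. -/
theorem exists_isExpander (L : Type*) [Nonempty L] :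
    ∃ (W : ℕ → Type) (H : ∀ n, LabelledGraph L (W n)), IsExpander H := by
  choose π hπ using fun n : ℕ => exists_perms_expanding (Fin (n + 2))
  -- Every label carries the same edges, since expansion only sees the underlying simple graph.
  let H : ∀ n, LabelledGraph L (Fin (n + 2)) := fun n => ⟨fun _ x y => ∃ i, π n i x = y⟩
  have hadj : ∀ n (x y : Fin (n + 2)), (H n).toSimpleGraph.Adj x y ↔
      x ≠ y ∧ ((∃ i, π n i x = y) ∨ ∃ i, π n i y = x) := fun n x y => by
    simp [H, LabelledGraph.toSimpleGraph, SimpleGraph.fromRel_adj]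
  have hexp : ∀ n (A : Finset (Fin (n + 2))), A.Nonempty → 2 * A.card ≤ n + 2 →
      ∃ T : Finset (Fin (n + 2)), A.card < 2 * T.card ∧
        ∀ y ∈ T, y ∉ A ∧ ∃ x ∈ A, (H n).toSimpleGraph.Adj x y := by
    intro n A hA hAn
    set U : Finset (Fin (n + 2)) := A ∪ Finset.univ.biUnion fun i => A.image (π n i) with hU
    refine ⟨U \ A, ?_, fun y hy => ?_⟩
    -- Otherwise U would fit into a set B of size exactly ⌊3|A|/2⌋ receiving A under all the
    -- permutations. Hence more than |A|/2 points outside A are adjacent to A.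
    · have hcard : 3 * A.card / 2 < U.card := by
        by_contra! hlt
        obtain ⟨B, hUB, -, hB⟩ := Finset.exists_subsuperset_card_eq (Finset.subset_univ U) hlt
          (by rw [Finset.card_univ, Fintype.card_fin]; omega)
        obtain ⟨i, x, hx, hxB⟩ := hπ n A B hA (by rwa [Fintype.card_fin]) hB
        refine hxB (hUB ?_)
        rw [hU, Finset.mem_union, Finset.mem_biUnion]
        exact Or.inr ⟨i, Finset.mem_univ _, Finset.mem_image_of_mem _ hx⟩
      have := Finset.card_sdiff_add_card_eq_card (show A ⊆ U from Finset.subset_union_left)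
      omega
    · rw [Finset.mem_sdiff] at hy
      refine ⟨hy.2, ?_⟩
      obtain ⟨i, -, hi⟩ := Finset.mem_biUnion.1 ((Finset.mem_union.1 hy.1).resolve_left hy.2)
      obtain ⟨x, hx, rfl⟩ := Finset.mem_image.1 hi
      exact ⟨x, hx, (hadj n _ _).2 ⟨fun h => hy.2 (h ▸ hx), Or.inl ⟨i, rfl⟩⟩⟩
  refine ⟨fun n => Fin (n + 2), H, ⟨fun n => inferInstance, fun n => ?_, ⟨46, fun n x => ?_⟩, ?_⟩,
    1 / 4, by norm_num, fun n => ?_⟩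
  · refine SimpleGraph.connected_of_exists_adj fun A hA hAn => ?_
    obtain ⟨T, hT, hTA⟩ := hexp n A hA (by simpa using hAn)
    obtain ⟨y, hy⟩ : T.Nonempty := Finset.card_pos.1 (by omega)
    obtain ⟨hyA, x, hx, hxy⟩ := hTA y hy
    exact ⟨x, hx, y, hyA, hxy⟩
  · have hsub : (H n).toSimpleGraph.neighborSet x ⊆
        ((Finset.univ.image fun i => π n i x) ∪ Finset.univ.image fun i => (π n i).symm x :
          Finset (Fin (n + 2))) := by
      intro y hy
      rw [SimpleGraph.mem_neighborSet, hadj] at hy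
      rcases hy.2 with ⟨i, hi⟩ | ⟨i, hi⟩
      · simpa using Or.inl ⟨i, hi⟩
      · simpa using Or.inr ⟨i, by rw [← hi]; simp⟩
    refine (Set.encard_le_encard hsub).trans ?_
    rw [Set.encard_coe_eq_coe_finsetCard]
    refine Nat.cast_le.2 ((Finset.card_union_le _ _).trans ?_)
    have h1 := Finset.card_image_le (s := Finset.univ) (f := fun i => π n i x)
    have h2 := Finset.card_image_le (s := Finset.univ) (f := fun i => (π n i).symm x)
    simp only [Finset.card_univ, Fintype.card_fin] at h1 h2
    omega
  · simpa using tendsto_add_atTop_nat 2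
  · refine lt_of_lt_of_le (by norm_num : (1 / 4 : ℝ) < 1 / 2) (le_csInf ?_ ?_)
    -- A singleton is admissible because there are at least two vertices; the infimum over an empty
    -- set would be 0.
    · exact ⟨_, {0}, by simp, by simp; linarith [Nat.cast_nonneg (α := ℝ) n], rfl⟩
    · rintro _ ⟨A, hA, hAn, rfl⟩
      lift A to Finset (Fin (n + 2)) using A.toFinite
      rw [Set.ncard_coe_finset] at *
      rw [Nat.card_eq_fintype_card, Fintype.card_fin, le_div_iff₀ two_pos] at hAn
      have hAn' : A.card * 2 ≤ n + 2 := by exact_mod_cast hAn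
      obtain ⟨T, hT, hTA⟩ := hexp n A (Finset.card_pos.1 hA) (by omega)
      have hg : ∀ y, ∃ x, y ∈ T → x ∈ A ∧ (H n).toSimpleGraph.Adj x y := fun y => by
        by_cases hy : y ∈ T
        · obtain ⟨x, hx, hxy⟩ := (hTA y hy).2
          exact ⟨x, fun _ => ⟨hx, hxy⟩⟩
        · exact ⟨y, fun h => absurd h hy⟩
      choose g hg using hg
      have hle : (T : Set (Fin (n + 2))).ncard ≤ {e ∈ (H n).toSimpleGraph.edgeSet |
          ∃ x ∈ (A : Set (Fin (n + 2))), ∃ y ∉ (A : Set (Fin (n + 2))), e = s(x, y)}.ncard := by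
        -- One boundary edge per point of T: it determines y as its end point outside A.
        refine Set.ncard_le_ncard_of_injOn (fun y => s(g y, y)) (fun y hy => ?_)
          (fun y hy z hz h => ?_) (Set.toFinite _)
        · exact ⟨(hg y hy).2, g y, (hg y hy).1, y, (hTA y hy).1, rfl⟩
        · rcases Sym2.eq_iff.1 h with h | h
          · exact h.2
          · exact absurd (h.1 ▸ (hg y hy).1) (hTA z hz).1
      rw [Set.ncard_coe_finset] at hle
      rw [le_div_iff₀ (by exact_mod_cast hA)]
      have hT' : (A.card : ℝ) < 2 * T.card := by exact_mod_cast hT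
      have hle' := (Nat.cast_le (α := ℝ)).2 hle
      linarith

end ExpanderExistence

theorem SimpleGraph.card_adj_pairs_le {V : Type*} [Fintype V] {G : SimpleGraph V} {d : ℕ}
    (hd : ∀ x, (G.neighborSet x).encard ≤ d) :
    {p : V × V | G.Adj p.1 p.2}.ncard ≤ d * Fintype.card V := by
  classical
  have h : {p : V × V | G.Adj p.1 p.2} =
      ((Finset.univ : Finset V).biUnion fun x =>
        (Finset.univ.filter fun y => G.Adj x y).image (Prod.mk x) : Finset (V × V)) := by
    ext ⟨x, y⟩
    simp
  rw [h, Set.ncard_coe_finset, mul_comm]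
  refine Finset.card_biUnion_le_card_mul _ _ d fun x _ => Finset.card_image_le.trans ?_
  have := hd x
  rw [show G.neighborSet x = (Finset.univ.filter fun y => G.Adj x y : Finset V) by ext; simp,
    Set.encard_coe_eq_coe_finsetCard] at this
  exact_mod_cast this

/-! ### One-point unions of labelled graphs -/

namespace LabelledGraph

section Glue

variable {L V W : Type*} {G : LabelledGraph L V} {H : LabelledGraph L W} {p : V} {q : W}

theorem toSimpleGraph_adj {x y : V} : G.toSimpleGraph.Adj x y ↔
    x ≠ y ∧ ((∃ s, G.Edge s x y) ∨ ∃ s, G.Edge s y x) := by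
  simp [toSimpleGraph, SimpleGraph.fromRel_adj]

theorem wedgeRight_self : wedgeRight p q q = Sum.inl p := by
  simp [wedgeRight]

theorem wedgeRight_of_ne {w : W} (h : w ≠ q) : wedgeRight p q w = Sum.inr ⟨w, h⟩ := by
  simp [wedgeRight, h]

/-- The two pieces meet in the gluing point only. -/
theorem inl_eq_wedgeRight_iff {x : V} {w : W} :
    (Sum.inl x : V ⊕ {w : W // w ≠ q}) = wedgeRight p q w ↔ x = p ∧ w = q := by
  by_cases h : w = q
  · subst h
    simp [wedgeRight_self]
  · simp [wedgeRight_of_ne h, h]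

theorem wedgeRight_injective : Function.Injective (wedgeRight p q) := by
  intro w w' h
  by_cases h1 : w = q
  · subst h1
    rw [wedgeRight_self, inl_eq_wedgeRight_iff] at h
    exact h.2.symm
  · by_cases h2 : w' = q
    · subst h2
      rw [wedgeRight_self] at h
      exact (inl_eq_wedgeRight_iff.1 h.symm).2
    · rw [wedgeRight_of_ne h1, wedgeRight_of_ne h2] at h
      simpa using h

theorem glue_adj {a b : V ⊕ {w : W // w ≠ q}} : (G.glue H p q).toSimpleGraph.Adj a b ↔
    (∃ x y, G.toSimpleGraph.Adj x y ∧ a = Sum.inl x ∧ b = Sum.inl y) ∨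
    ∃ x y, H.toSimpleGraph.Adj x y ∧ a = wedgeRight p q x ∧ b = wedgeRight p q y := by
  simp only [toSimpleGraph_adj, glue]
  constructor
  · rintro ⟨hab, ⟨s, ⟨x, y, h, rfl, rfl⟩ | ⟨x, y, h, rfl, rfl⟩⟩ |
      ⟨s, ⟨x, y, h, rfl, rfl⟩ | ⟨x, y, h, rfl, rfl⟩⟩⟩
    · exact Or.inl ⟨x, y, ⟨fun e => hab (e ▸ rfl), Or.inl ⟨s, h⟩⟩, rfl, rfl⟩
    · exact Or.inr ⟨x, y, ⟨fun e => hab (e ▸ rfl), Or.inl ⟨s, h⟩⟩, rfl, rfl⟩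
    · exact Or.inl ⟨y, x, ⟨fun e => hab (e ▸ rfl), Or.inr ⟨s, h⟩⟩, rfl, rfl⟩
    · exact Or.inr ⟨y, x, ⟨fun e => hab (e ▸ rfl), Or.inr ⟨s, h⟩⟩, rfl, rfl⟩
  · rintro (⟨x, y, ⟨hne, h⟩, rfl, rfl⟩ | ⟨x, y, ⟨hne, h⟩, rfl, rfl⟩)
    · refine ⟨fun e => hne (Sum.inl_injective e), h.imp ?_ ?_⟩
      · exact fun ⟨s, hs⟩ => ⟨s, Or.inl ⟨x, y, hs, rfl, rfl⟩⟩
      · exact fun ⟨s, hs⟩ => ⟨s, Or.inl ⟨y, x, hs, rfl, rfl⟩⟩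
    · refine ⟨fun e => hne (wedgeRight_injective e), h.imp ?_ ?_⟩
      · exact fun ⟨s, hs⟩ => ⟨s, Or.inr ⟨x, y, hs, rfl, rfl⟩⟩
      · exact fun ⟨s, hs⟩ => ⟨s, Or.inr ⟨y, x, hs, rfl, rfl⟩⟩

theorem glue_connected (hG : G.toSimpleGraph.Connected) (hH : H.toSimpleGraph.Connected) :
    (G.glue H p q).toSimpleGraph.Connected := by
  let f : G.toSimpleGraph →g (G.glue H p q).toSimpleGraph :=
    ⟨Sum.inl, fun h => glue_adj.2 (Or.inl ⟨_, _, h, rfl, rfl⟩)⟩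
  let g : H.toSimpleGraph →g (G.glue H p q).toSimpleGraph :=
    ⟨wedgeRight p q, fun h => glue_adj.2 (Or.inr ⟨_, _, h, rfl, rfl⟩)⟩
  have key : ∀ a, (G.glue H p q).toSimpleGraph.Reachable (Sum.inl p) a := by
    rintro (x | ⟨w, hw⟩)
    · exact (hG.preconnected p x).map f
    · have := (hH.preconnected q w).map g
      rw [show g q = Sum.inl p from wedgeRight_self, show g w = _ from wedgeRight_of_ne hw] at this
      exact this
  exact (SimpleGraph.connected_iff _).2 ⟨fun a b => (key a).symm.trans (key b), ⟨Sum.inl p⟩⟩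

theorem glue_encard_neighborSet_le {d e : ℕ}
    (hG : ∀ x, (G.toSimpleGraph.neighborSet x).encard ≤ d)
    (hH : ∀ x, (H.toSimpleGraph.neighborSet x).encard ≤ e) (a : V ⊕ {w : W // w ≠ q}) :
    ((G.glue H p q).toSimpleGraph.neighborSet a).encard ≤ (d + e : ℕ) := by
  have key : ∃ x w, (G.glue H p q).toSimpleGraph.neighborSet a ⊆
      Sum.inl '' G.toSimpleGraph.neighborSet x ∪
        wedgeRight p q '' H.toSimpleGraph.neighborSet w := by
    rcases a with x | ⟨w, hw⟩
    · refine ⟨x, q, fun b hb => ?_⟩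
      rcases glue_adj.1 hb with ⟨x', y, h, hx, rfl⟩ | ⟨x', y, h, hx, rfl⟩
      · obtain rfl := Sum.inl_injective hx
        exact Or.inl ⟨y, h, rfl⟩
      · obtain ⟨-, rfl⟩ := inl_eq_wedgeRight_iff.1 hx
        exact Or.inr ⟨y, h, rfl⟩
    · refine ⟨p, w, fun b hb => ?_⟩
      rcases glue_adj.1 hb with ⟨x', y, h, hx, rfl⟩ | ⟨x', y, h, hx, rfl⟩
      · cases hx
      · rw [← wedgeRight_of_ne hw] at hx
        obtain rfl := wedgeRight_injective hx
        exact Or.inr ⟨y, h, rfl⟩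
  obtain ⟨x, w, h⟩ := key
  refine (Set.encard_le_encard h).trans ((Set.encard_union_le _ _).trans ?_)
  rw [Sum.inl_injective.encard_image, wedgeRight_injective.encard_image, Nat.cast_add]
  exact add_le_add (hG x) (hH w)

theorem card_glue [Finite V] [Finite W] (q : W) :
    Nat.card (V ⊕ {w : W // w ≠ q}) + 1 = Nat.card V + Nat.card W := by
  classical
  have := Fintype.ofFinite V
  have := Fintype.ofFinite W
  have hW : 0 < Fintype.card W := Fintype.card_pos_iff.2 ⟨q⟩
  simp only [Nat.card_eq_fintype_card, Fintype.card_sum, ne_eq, Fintype.card_subtype_compl,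
    Fintype.card_subtype_eq]
  omega

/-- A walk leaving G must pass through p, which is out of reach within r steps. -/
theorem mem_ball_glue_inl {x : V} {r : ℕ} (hp : p ∉ G.ball x r) {a : V ⊕ {w : W // w ≠ q}} :
    a ∈ (G.glue H p q).ball (Sum.inl x) r ↔ ∃ y ∈ G.ball x r, a = Sum.inl y := by
  simp only [ball, Set.mem_ofPred_eq] at hp ⊢
  induction r generalizing a with
  | zero =>
    simp only [Nat.cast_zero, nonpos_iff_eq_zero, SimpleGraph.edist_eq_zero_iff]
    constructor
    · rintro rfl
      exact ⟨x, rfl, rfl⟩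
    · rintro ⟨y, rfl, rfl⟩
      rfl
  | succ r ih =>
    have hp' : ¬ G.toSimpleGraph.edist x p ≤ r :=
      fun h => hp (SimpleGraph.edist_le_succ_iff.2 (Or.inl h))
    simp only [SimpleGraph.edist_le_succ_iff, ih hp']
    constructor
    · rintro (⟨y, hy, rfl⟩ | ⟨_, ⟨y, hy, rfl⟩, hadj⟩)
      · exact ⟨y, Or.inl hy, rfl⟩
      · rcases glue_adj.1 hadj with ⟨x', y', h, hx, rfl⟩ | ⟨x', y', h, hx, rfl⟩
        · obtain rfl := Sum.inl_injective hx
          exact ⟨y', Or.inr ⟨_, hy, h⟩, rfl⟩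
        · obtain ⟨rfl, -⟩ := inl_eq_wedgeRight_iff.1 hx
          exact absurd hy hp'
    · rintro ⟨y, hy | ⟨z, hz, hzy⟩, rfl⟩
      · exact Or.inl ⟨y, hy, rfl⟩
      · exact Or.inr ⟨_, ⟨z, hz, rfl⟩, glue_adj.2 (Or.inl ⟨z, y, hzy, rfl, rfl⟩)⟩

/-- The point p is excluded because a loop of H at q becomes a loop at p. -/
theorem glue_edge_inl_iff {s : L} {x y : V} (hx : x ≠ p) :
    (G.glue H p q).Edge s (Sum.inl x) (Sum.inl y) ↔ G.Edge s x y := by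
  constructor
  · rintro (⟨x', y', h, e, e'⟩ | ⟨x', y', h, e, e'⟩)
    · rwa [Sum.inl_injective e, Sum.inl_injective e']
    · exact absurd (inl_eq_wedgeRight_iff.1 e).1 hx
  · exact fun h => Or.inl ⟨x, y, h, rfl, rfl⟩

end Glue

/-! ### Cayley graphs of quotients and their balls -/

section Cayley

variable {L Γ Q W : Type*} [Group Γ] [Group Q]

theorem cayley_adj {ι : L → Γ} {x y : Γ} : (cayley ι).toSimpleGraph.Adj x y ↔
    x ≠ y ∧ ((∃ s, x * ι s = y) ∨ ∃ s, y * ι s = x) :=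
  toSimpleGraph_adj

theorem cayley_encard_neighborSet_le [Fintype L] (ι : L → Γ) (x : Γ) :
    ((cayley ι).toSimpleGraph.neighborSet x).encard ≤ (2 * Fintype.card L : ℕ) := by
  classical
  have hsub : (cayley ι).toSimpleGraph.neighborSet x ⊆
      ((Finset.univ.image fun s => x * ι s) ∪ Finset.univ.image fun s => x * (ι s)⁻¹ :
        Finset Γ) := by
    intro y hy
    rcases (cayley_adj.1 hy).2 with ⟨s, rfl⟩ | ⟨s, rfl⟩
    · simp
    · rw [Finset.mem_coe, Finset.mem_union]
      exact Or.inr (Finset.mem_image.2 ⟨s, Finset.mem_univ _, mul_inv_cancel_right _ _⟩)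
  refine (Set.encard_le_encard hsub).trans ?_
  rw [Set.encard_coe_eq_coe_finsetCard]
  refine Nat.cast_le.2 ((Finset.card_union_le _ _).trans ?_)
  have h1 := Finset.card_image_le (s := Finset.univ) (f := fun s => x * ι s)
  have h2 := Finset.card_image_le (s := Finset.univ) (f := fun s => x * (ι s)⁻¹)
  rw [Finset.card_univ] at h1 h2
  omega

theorem cayley_connected {ι : L → Γ} (f : Γ →* Q) (hf : Function.Surjective f)
    (hι : Subgroup.closure (Set.range ι) = ⊤) :
    (cayley fun s => f (ι s)).toSimpleGraph.Connected := by
  have key : ∀ g ∈ Subgroup.closure (Set.range ι), ∀ x : Q,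
      (cayley fun s => f (ι s)).toSimpleGraph.Reachable x (x * f g) := by
    intro g hg
    induction hg using Subgroup.closure_induction with
    | mem g hg =>
      obtain ⟨s, rfl⟩ := hg
      intro x
      by_cases h : x = x * f (ι s)
      · rw [← h]
      · exact (cayley_adj.2 ⟨h, Or.inl ⟨s, rfl⟩⟩).reachable
    | one => intro x; simp
    | mul a b _ _ ha hb =>
      intro x
      rw [map_mul, ← mul_assoc]
      exact (ha x).trans (hb _)
    | inv a _ ha =>
      intro x
      have := ha (x * f a⁻¹)
      rw [mul_assoc, ← map_mul, inv_mul_cancel, map_one, mul_one] at this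
      exact this.symm
  refine (SimpleGraph.connected_iff _).2 ⟨fun x y => ?_, ⟨1⟩⟩
  obtain ⟨g, hg⟩ := hf (x⁻¹ * y)
  have := key g (hι ▸ Subgroup.mem_top g) x
  rwa [hg, mul_inv_cancel_left] at this

/-- Each edge of the image graph lifts to the Cayley graph of Γ, so walks from x lift to walks from
1 of the same length. -/
theorem mem_ball_cayley_map {ι : L → Γ} (f : Γ →* Q) {x y : Q} {r : ℕ} :
    y ∈ (cayley fun s => f (ι s)).ball x r ↔ ∃ g ∈ (cayley ι).ball 1 r, y = x * f g := by
  simp only [ball, Set.mem_ofPred_eq]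
  induction r generalizing y with
  | zero =>
    simp only [Nat.cast_zero, nonpos_iff_eq_zero, SimpleGraph.edist_eq_zero_iff]
    constructor
    · rintro rfl
      exact ⟨1, rfl, by simp⟩
    · rintro ⟨g, rfl, rfl⟩
      simp
  | succ r ih =>
    simp only [SimpleGraph.edist_le_succ_iff, ih]
    constructor
    · rintro (⟨g, hg, rfl⟩ | ⟨_, ⟨g, hg, rfl⟩, hadj⟩)
      · exact ⟨g, Or.inl hg, rfl⟩
      · rcases (cayley_adj.1 hadj) with ⟨hne, ⟨s, rfl⟩ | ⟨s, hs⟩⟩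
        · refine ⟨g * ι s, Or.inr ⟨g, hg, cayley_adj.2 ⟨fun h => hne ?_, Or.inl ⟨s, rfl⟩⟩⟩, ?_⟩
          · nth_rewrite 1 [h]
            rw [map_mul, mul_assoc]
          · rw [map_mul, mul_assoc]
        · have hy : y = x * f (g * (ι s)⁻¹) := by
            rw [map_mul, ← mul_assoc, ← hs, map_inv, mul_inv_cancel_right]
          refine ⟨g * (ι s)⁻¹, Or.inr ⟨g, hg, cayley_adj.2 ⟨fun h => hne ?_, Or.inr ⟨s, ?_⟩⟩⟩, hy⟩
          · rw [hy, ← h]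
          · rw [inv_mul_cancel_right]
    · rintro ⟨g, hg | ⟨z, hz, hzg⟩, rfl⟩
      · exact Or.inl ⟨g, hg, rfl⟩
      -- An edge may collapse to a loop, which the simple graph forgets; the point then already lies
      -- in the smaller ball.
      · by_cases h : x * f z = x * f g
        · exact Or.inl ⟨z, hz, h.symm⟩
        · refine Or.inr ⟨_, ⟨z, hz, rfl⟩, cayley_adj.2 ⟨h, ?_⟩⟩
          rcases (cayley_adj.1 hzg).2 with ⟨s, rfl⟩ | ⟨s, rfl⟩
          · exact Or.inl ⟨s, by rw [map_mul, mul_assoc]⟩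
          · exact Or.inr ⟨s, by rw [map_mul, mul_assoc]⟩

/-- Away from the gluing point and at scales where `f` is injective, the balls of the one-point
union are the balls of the Cayley graph of `Γ`. -/
theorem ballIso_glue_cayley {ι : L → Γ} (f : Γ →* Q) {H : LabelledGraph L W} {p : Q} {q : W}
    {x : Q} {r : ℕ} (hp : p ∉ (cayley fun s => f (ι s)).ball x r)
    (hf : ∀ a ∈ (cayley ι).ball 1 r, ∀ b ∈ (cayley ι).ball 1 (r + 1), f a = f b → a = b) :
    ((cayley fun s => f (ι s)).glue H p q).BallIso (Sum.inl x) (cayley ι) 1 r := by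
  have hmono : ∀ a ∈ (cayley ι).ball 1 r, a ∈ (cayley ι).ball 1 (r + 1) := fun a ha =>
    SimpleGraph.edist_le_succ_iff.2 (Or.inl ha)
  have hmem : ∀ a ∈ (cayley ι).ball 1 r, x * f a ∈ (cayley fun s => f (ι s)).ball x r :=
    fun a ha => (mem_ball_cayley_map f).2 ⟨a, ha, rfl⟩
  let e : (cayley ι).ball 1 r → ((cayley fun s => f (ι s)).glue H p q).ball (Sum.inl x) r :=
    fun a => ⟨Sum.inl (x * f a), (mem_ball_glue_inl hp).2 ⟨_, hmem a a.2, rfl⟩⟩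
  have he : Function.Bijective e := by
    constructor
    · intro a b hab
      have h1 : x * f a = x * f b := Sum.inl_injective (congrArg Subtype.val hab)
      exact Subtype.ext (hf a a.2 b (hmono b b.2) (mul_left_cancel h1))
    · rintro ⟨y, hy⟩
      obtain ⟨z, hz, rfl⟩ := (mem_ball_glue_inl hp).1 hy
      obtain ⟨g, hg, rfl⟩ := (mem_ball_cayley_map f).1 hz
      exact ⟨⟨g, hg⟩, rfl⟩
  refine ⟨(Equiv.ofBijective e he).symm, ?_, fun s a b => ?_⟩
  · rw [Equiv.symm_apply_eq]
    simp [e]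
  · obtain ⟨a, rfl⟩ := (Equiv.ofBijective e he).surjective a
    obtain ⟨b, rfl⟩ := (Equiv.ofBijective e he).surjective b
    rw [Equiv.symm_apply_apply, Equiv.symm_apply_apply, Equiv.ofBijective_apply,
      Equiv.ofBijective_apply]
    have hne : x * f a ≠ p := fun h => hp (h ▸ hmem a a.2)
    simp only [e]
    rw [glue_edge_inl_iff hne]
    simp only [cayley]
    rw [mul_assoc, mul_right_inj, ← map_mul]
    constructor
    · intro h
      -- A priori `a * ι s` lies only in the ball of radius r + 1; hence the larger radius in `hf`.
      refine (hf b b.2 _ ?_ h.symm).symm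
      refine SimpleGraph.edist_le_succ_iff.2 ?_
      by_cases h' : (a : Γ) = a * ι s
      · left
        rw [← h']
        exact a.2
      · exact Or.inr ⟨a, a.2, cayley_adj.2 ⟨h', Or.inl ⟨s, rfl⟩⟩⟩
    · exact fun h => h ▸ rfl

end Cayley

end LabelledGraph

/-! ### Filtrations: injectivity on finite sets and growth of the quotients -/

section Filtration

variable {Γ : Type*} [Group Γ] {N : ℕ → FiniteIndexNormalSubgroup Γ}

/-- A nontrivial element misses some member of the filtration and hence all later ones; this is
applied to the finitely many nontrivial a⁻¹b with a, b in F. -/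
theorem IsGroupFiltration.eventually_injOn (hN : IsGroupFiltration N) (F : Finset Γ) :
    ∀ᶠ k in atTop, Set.InjOn (QuotientGroup.mk' (N k).toSubgroup) F := by
  have key : ∀ g : Γ, g ≠ 1 → ∀ᶠ k in atTop, g ∉ (N k).toSubgroup := fun g hg => by
    have : g ∉ ⨅ k, (N k).toSubgroup := by
      rw [hN.2]
      exact fun h => hg (Subgroup.mem_bot.1 h)
    rw [Subgroup.mem_iInf, not_forall] at this
    obtain ⟨K, hK⟩ := this
    exact eventually_atTop.2 ⟨K, fun k hk h => hK (hN.1 hk h)⟩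
  have h2 : ∀ᶠ k in atTop, ∀ a ∈ F, ∀ b ∈ F, a ≠ b → a⁻¹ * b ∉ (N k).toSubgroup := by
    rw [Filter.eventually_all_finset]
    intro a _
    rw [Filter.eventually_all_finset]
    intro b _
    by_cases h : a = b
    · exact Eventually.of_forall fun k h' => absurd h h'
    · filter_upwards [key (a⁻¹ * b) (fun h' => h (inv_mul_eq_one.1 h'))] with k hk _ using hk
  filter_upwards [h2] with k hk a ha b hb hab
  by_contra hne
  exact hk a ha b hb hne (QuotientGroup.eq.1 hab)

theorem FiniteIndexNormalSubgroup.card_quotient_pos (K : FiniteIndexNormalSubgroup Γ) :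
    0 < Nat.card (Γ ⧸ K.toSubgroup) := by
  have := K.isFiniteIndex'
  exact Nat.card_pos

theorem IsGroupFiltration.card_quotient_mono (hN : IsGroupFiltration N) :
    Monotone fun k => Nat.card (Γ ⧸ (N k).toSubgroup) := fun i j hij =>
  Nat.le_of_dvd (N j).card_quotient_pos
    (Subgroup.index_dvd_of_le (H := (N j).toSubgroup) (K := (N i).toSubgroup) (hN.1 hij))

theorem IsGroupFiltration.exists_le_card_quotient [Infinite Γ] (hN : IsGroupFiltration N)
    (m : ℕ) : ∃ k, m ≤ Nat.card (Γ ⧸ (N k).toSubgroup) := by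
  classical
  obtain ⟨F, rfl⟩ := Infinite.exists_subset_card_eq Γ m
  obtain ⟨k, hk⟩ := (hN.eventually_injOn F).exists
  have := (N k).isFiniteIndex'
  have := Fintype.ofFinite (Γ ⧸ (N k).toSubgroup)
  refine ⟨k, ?_⟩
  rw [← Finset.card_image_of_injOn hk, Nat.card_eq_fintype_card]
  exact Finset.card_le_univ _

/-- Indices below K give quotients no larger than the one at K, so each K is passed once n exceeds
that order. -/
theorem IsGroupFiltration.tendsto_atTop_of_card (hN : IsGroupFiltration N) {k : ℕ → ℕ}
    (hk : ∀ n, n ≤ Nat.card (Γ ⧸ (N (k n)).toSubgroup)) : Tendsto k atTop atTop := by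
  refine tendsto_atTop.2 fun K => ?_
  filter_upwards [eventually_gt_atTop (Nat.card (Γ ⧸ (N K).toSubgroup))] with n hn
  by_contra! hlt
  have h1 : Nat.card (Γ ⧸ (N (k n)).toSubgroup) ≤ Nat.card (Γ ⧸ (N K).toSubgroup) :=
    hN.card_quotient_mono hlt.le
  have h2 := hk n
  omega

end Filtration

/-! ### Glued sequences and soficity -/

section GlueSequence

variable {L : Type*} {V W : ℕ → Type*}

theorem isGraphSequence_glue {G : ∀ n, LabelledGraph L (V n)} {H : ∀ n, LabelledGraph L (W n)}
    [∀ n, Finite (V n)] (hG : ∀ n, (G n).toSimpleGraph.Connected) {d : ℕ}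
    (hd : ∀ n x, ((G n).toSimpleGraph.neighborSet x).encard ≤ d) (hH : IsGraphSequence H)
    (p : ∀ n, V n) (q : ∀ n, W n) : IsGraphSequence fun n => (G n).glue (H n) (p n) (q n) where
  finite n := by
    have := hH.finite n
    infer_instance
  connected n := LabelledGraph.glue_connected (hG n) (hH.connected n)
  bounded_degree := by
    obtain ⟨e, he⟩ := hH.bounded_degree
    exact ⟨d + e, fun n => LabelledGraph.glue_encard_neighborSet_le (hd n) (he n)⟩
  tendsto_card := by
    refine tendsto_atTop_mono (fun n => ?_) hH.tendsto_card
    have := hH.finite n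
    have h1 := LabelledGraph.card_glue (V := V n) (q n)
    have : 0 < Nat.card (V n) := Nat.card_pos_iff.2 ⟨⟨p n⟩, inferInstance⟩
    omega

end GlueSequence

section Sofic

variable {L Γ : Type*} [Fintype L] [Group Γ] {N : ℕ → FiniteIndexNormalSubgroup Γ}

theorem cayley_ball_finset (ι : L → Γ) (r : ℕ) :
    ∃ F : Finset Γ, ∀ g ∈ (LabelledGraph.cayley ι).ball 1 r, g ∈ F :=
  let ⟨F, hF, _⟩ := SimpleGraph.exists_finset_ball_subset
    (LabelledGraph.cayley_encard_neighborSet_le ι) 1 r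
  ⟨F, hF⟩

/-- Gluing small graphs to the members of a box space yields a sofic approximation. -/
theorem isSoficApproximation_glue {ι : L → Γ} (hι : Subgroup.closure (Set.range ι) = ⊤)
    (hN : IsGroupFiltration N) {W : ℕ → Type*} {H : ∀ n, LabelledGraph L (W n)}
    (hH : IsGraphSequence H) {k : ℕ → ℕ}
    (hk : ∀ n : ℕ, (Nat.card (W n) : ℝ) / (Nat.card (Γ ⧸ (N (k n)).toSubgroup) : ℝ) <
      1 / ((n : ℝ) + 1))
    (hkt : Tendsto k atTop atTop)
    (hkn : ∀ n, n + 1 ≤ Nat.card (Γ ⧸ (N (k n)).toSubgroup))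
    (p : ∀ n, Γ ⧸ (N (k n)).toSubgroup) (q : ∀ n, W n) :
    IsSoficApproximation ι fun n => (LabelledGraph.cayley fun s =>
      QuotientGroup.mk' (N (k n)).toSubgroup (ι s)).glue (H n) (p n) (q n) := by
  classical
  refine ⟨isGraphSequence_glue (fun n => LabelledGraph.cayley_connected _
    (QuotientGroup.mk'_surjective _) hι)
    (fun n => LabelledGraph.cayley_encard_neighborSet_le _) hH p q, fun r => ?_⟩
  obtain ⟨F, hF⟩ := cayley_ball_finset ι (r + 1)
  set D := F.card with hD
  have hF' : ∀ g ∈ (LabelledGraph.cayley ι).ball 1 r, g ∈ F := fun g hg =>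
    hF g (SimpleGraph.edist_le_succ_iff.2 (Or.inl hg))
  -- At most D vertices of the quotient lie near the gluing point, and the expander is smaller than
  -- the quotient by a factor n + 1, whose order is at least n + 1; hence the error (D + 1)/(n + 1).
  refine tendsto_of_tendsto_of_tendsto_of_le_of_le'
    (g := fun n : ℕ => 1 - ((D : ℝ) + 1) * (1 / ((n : ℝ) + 1))) (h := fun _ => 1)
    ?_ tendsto_const_nhds ?_ ?_
  · simpa using (tendsto_one_div_add_atTop_nhds_zero_nat (𝕜 := ℝ)).const_mul ((D : ℝ) + 1)
      |>.const_sub 1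
  · filter_upwards [hkt.eventually (hN.eventually_injOn F)] with n hinj
    set f := QuotientGroup.mk' (N (k n)).toSubgroup
    have hfin := hH.finite n
    set T := {x : (Γ ⧸ (N (k n)).toSubgroup) ⊕ {w : W n // w ≠ q n} |
      ((LabelledGraph.cayley fun s => f (ι s)).glue (H n) (p n) (q n)).BallIso x
        (LabelledGraph.cayley ι) 1 r} with hT
    set B : Finset (Γ ⧸ (N (k n)).toSubgroup) := F.image fun g => p n * f g with hB
    -- B contains the r-ball about the gluing point, so by symmetry of the distance the r-balls of
    -- points outside B miss it.
    have hsub : Sum.inl '' ((B : Set (Γ ⧸ (N (k n)).toSubgroup))ᶜ) ⊆ T := by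
      rintro _ ⟨x, hx, rfl⟩
      refine LabelledGraph.ballIso_glue_cayley f (fun hp => hx ?_)
        fun a ha b hb h => hinj (hF' a ha) (hF b hb) h
      have hx' : x ∈ (LabelledGraph.cayley fun s => f (ι s)).ball (p n) r := by
        rw [LabelledGraph.ball, Set.mem_ofPred_eq, SimpleGraph.edist_comm]
        exact hp
      obtain ⟨g, hg, rfl⟩ := (LabelledGraph.mem_ball_cayley_map f).1 hx'
      exact Finset.mem_image_of_mem _ (hF' g hg)
    have h1 : Nat.card (Γ ⧸ (N (k n)).toSubgroup) ≤ T.ncard + D := by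
      have h2 := Set.ncard_le_ncard hsub (Set.toFinite _)
      rw [Set.ncard_image_of_injective _ Sum.inl_injective] at h2
      have h3 := Set.ncard_add_ncard_compl (B : Set (Γ ⧸ (N (k n)).toSubgroup))
      have h4 : B.card ≤ D := Finset.card_image_le
      rw [Set.ncard_coe_finset] at h3
      omega
    have h2 := LabelledGraph.card_glue (V := Γ ⧸ (N (k n)).toSubgroup) (q n)
    have h3 := hk n
    have h4 := hkn n
    generalize Nat.card ((Γ ⧸ (N (k n)).toSubgroup) ⊕ {w : W n // w ≠ q n}) = v at h2 ⊢
    generalize Nat.card (Γ ⧸ (N (k n)).toSubgroup) = Q at h1 h2 h3 h4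
    generalize Nat.card (W n) = w at h2 h3
    have hn : (0 : ℝ) < (n : ℝ) + 1 := by positivity
    have hQ : (0 : ℝ) < Q := by exact_mod_cast (by omega : 0 < Q)
    have h1' : (Q : ℝ) ≤ T.ncard + D := by exact_mod_cast h1
    have h2' : (v : ℝ) + 1 = Q + w := by exact_mod_cast h2
    have h4' : (n : ℝ) + 1 ≤ Q := by exact_mod_cast h4
    rw [div_lt_div_iff₀ hQ hn] at h3
    have hD0 : (0 : ℝ) ≤ D := Nat.cast_nonneg _
    rcases Nat.eq_zero_or_pos v with hv0 | hv0
    · subst hv0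
      simp only [Nat.cast_zero, div_zero]
      have : (Q : ℝ) ≤ 1 := by
        have : (0 : ℝ) ≤ w := Nat.cast_nonneg _
        simp only [Nat.cast_zero] at h2'
        linarith
      rw [sub_nonpos, ← mul_div_assoc, mul_one, one_le_div hn]
      linarith
    · have hv : (0 : ℝ) < v := by exact_mod_cast hv0
      rw [le_div_iff₀ hv]
      have hw0 : (0 : ℝ) ≤ w := Nat.cast_nonneg _
      set m : ℝ := (n : ℝ) + 1
      have hb : 1 - ((D : ℝ) + 1) * (1 / m) = (m - (D + 1)) / m := by
        field_simp
      rw [hb, div_mul_eq_mul_div, div_le_iff₀ hn]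
      rcases le_total m (D + 1) with hm | hm
      · have : (0 : ℝ) ≤ T.ncard := Nat.cast_nonneg _
        nlinarith
      · have e1 : (m - (D + 1)) * v ≤ (m - (D + 1)) * (Q + w) :=
          mul_le_mul_of_nonneg_left (by linarith) (by linarith)
        have e2 : ((Q : ℝ) - D) * m ≤ T.ncard * m :=
          mul_le_mul_of_nonneg_right (by linarith) hn.le
        nlinarith [mul_nonneg hD0 hw0, mul_nonneg hD0 (sub_nonneg.2 h4')]
  · refine Eventually.of_forall fun n => ?_
    have hfin := hH.finite n
    refine div_le_one_of_le₀ (Nat.cast_le.2 ?_) (Nat.cast_nonneg _)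
    rw [← Set.ncard_univ]
    exact Set.ncard_le_ncard (Set.subset_univ _) (Set.toFinite _)

end Sofic

/-! ### Random orders and partitions from Følner sets -/

section RandomOrder

variable {Q : Type*} [Fintype Q]

open Classical in
/-- In a uniformly random order, every point of `U` is equally likely to be the least one. -/
theorem card_mul_card_orders_min (U D : Finset Q) (hD : D ⊆ U) :
    U.card * (Finset.univ.filter fun σ : Q ≃ Fin (Fintype.card Q) =>
      ∃ u ∈ D, ∀ v ∈ U, σ u ≤ σ v).card ≤
      D.card * Fintype.card (Q ≃ Fin (Fintype.card Q)) := by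
  let M : Q → Finset (Q ≃ Fin (Fintype.card Q)) := fun u =>
    Finset.univ.filter fun σ => ∀ v ∈ U, σ u ≤ σ v
  rcases D.eq_empty_or_nonempty with rfl | ⟨u₀, hu₀⟩
  · simp
  have hM : ∀ u ∈ U, (M u).card = (M u₀).card := by
    intro u hu
    have hsw : ∀ v ∈ U, Equiv.swap u u₀ v ∈ U := fun v hv => by
      by_cases h1 : v = u
      · subst h1; simpa using hD hu₀
      · by_cases h2 : v = u₀
        · subst h2; simpa using hu
        · rwa [Equiv.swap_apply_of_ne_of_ne h1 h2]
    refine Finset.card_bij' (fun σ _ => (Equiv.swap u u₀).trans σ)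
      (fun σ _ => (Equiv.swap u u₀).trans σ) (fun σ hσ => ?_) (fun σ hσ => ?_)
      (fun σ _ => ?_) (fun σ _ => ?_)
    · simp only [M, Finset.mem_filter, Finset.mem_univ, true_and, Equiv.trans_apply,
        Equiv.swap_apply_right] at hσ ⊢
      exact fun v hv => hσ _ (hsw v hv)
    · simp only [M, Finset.mem_filter, Finset.mem_univ, true_and, Equiv.trans_apply,
        Equiv.swap_apply_left] at hσ ⊢
      exact fun v hv => hσ _ (hsw v hv)
    · ext; simp
    · ext; simp
  -- The least point is unique, so the |U| equally large events `M u` are disjoint.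
  have hdisj : (U : Set Q).PairwiseDisjoint M := by
    intro u hu v hv huv
    refine Finset.disjoint_left.2 fun σ h1 h2 => huv ?_
    simp only [M, Finset.mem_filter, Finset.mem_univ, true_and] at h1 h2
    exact σ.injective (le_antisymm (h1 v hv) (h2 u hu))
  have h1 : U.card * (M u₀).card ≤ Fintype.card (Q ≃ Fin (Fintype.card Q)) := by
    rw [← smul_eq_mul, ← Finset.sum_const, ← Finset.sum_congr rfl hM,
      ← Finset.card_biUnion hdisj]
    exact Finset.card_le_univ _
  have h2 : (Finset.univ.filter fun σ : Q ≃ Fin (Fintype.card Q) =>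
      ∃ u ∈ D, ∀ v ∈ U, σ u ≤ σ v).card ≤ D.card * (M u₀).card := by
    rw [← smul_eq_mul, ← Finset.sum_const,
      ← Finset.sum_congr rfl (fun u hu => hM u (hD hu))]
    refine (Finset.card_le_card fun σ hσ => ?_).trans Finset.card_biUnion_le
    simp only [Finset.mem_filter, Finset.mem_univ, true_and] at hσ
    obtain ⟨u, hu, h⟩ := hσ
    exact Finset.mem_biUnion.2 ⟨u, hu, by simpa [M] using h⟩
  calc U.card * _ ≤ U.card * (D.card * (M u₀).card) := Nat.mul_le_mul_left _ h2
    _ = D.card * (U.card * (M u₀).card) := by ring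
    _ ≤ _ := Nat.mul_le_mul_left _ h1

open Classical in
/-- Følner sets which embed into a finite quotient yield partitions of the quotient into cells of
bounded size which cut few edges. -/
theorem exists_cells {L Γ : Type*} [Fintype L] [Group Γ] [Group Q] (f : Γ →* Q) (ι : L → Γ)
    (E : Finset Γ) (hE : E.Nonempty) (hf : Set.InjOn f E) {δ : ℝ}
    (hδ : ∀ s, ((symmDiff (E.image fun x => ι s * x) E).card : ℝ) ≤ δ * E.card) :
    ∃ a : Q → Q, (∀ y, (Finset.univ.filter fun x => a x = y).card ≤ E.card) ∧
      ((Finset.univ.filter fun z : Q × L => a z.1 ≠ a (z.1 * f (ι z.2))).card : ℝ) ≤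
        δ * (Fintype.card Q * Fintype.card L) := by
  -- The point x selects the σ-least element `a σ x` of its Følner translate, and the fibres of `a
  -- σ` are the cells.
  let N : Q → Finset Q := fun x => E.image fun e => x * f e
  have hN : ∀ x, (N x).Nonempty := fun x => hE.image _
  choose a haN hamin using fun (σ : Q ≃ Fin (Fintype.card Q)) (x : Q) =>
    (N x).exists_min_image σ (hN x)
  have hNcard : ∀ x, (N x).card = E.card := fun x =>
    Finset.card_image_of_injOn fun u hu v hv h => hf hu hv (mul_left_cancel h)
  set M := Fintype.card (Q ≃ Fin (Fintype.card Q))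
  have hEpos : (0 : ℝ) < E.card := by exact_mod_cast hE.card_pos
  have hsymm : ∀ x s, (symmDiff (N x) (N (x * f (ι s)))).card ≤
      (symmDiff (E.image fun y => ι s * y) E).card := fun x s => by
    refine (Finset.card_le_card (t := (symmDiff (E.image fun y => ι s * y) E).image
      fun e => x * f e) fun u hu => ?_).trans Finset.card_image_le
    rw [Finset.mem_symmDiff] at hu
    rcases hu with ⟨h1, h2⟩ | ⟨h1, h2⟩
    · obtain ⟨e, he, rfl⟩ := Finset.mem_image.1 h1
      refine Finset.mem_image_of_mem _ (Finset.mem_symmDiff.2 (Or.inr ⟨he, fun h => h2 ?_⟩))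
      obtain ⟨e', he', rfl⟩ := Finset.mem_image.1 h
      exact Finset.mem_image.2 ⟨e', he', by rw [map_mul, mul_assoc]⟩
    · obtain ⟨e, he, rfl⟩ := Finset.mem_image.1 h1
      refine Finset.mem_image.2 ⟨ι s * e, Finset.mem_symmDiff.2 (Or.inl
        ⟨Finset.mem_image_of_mem _ he, fun h => h2 ?_⟩), by rw [map_mul, mul_assoc]⟩
      exact Finset.mem_image.2 ⟨_, h, by rw [map_mul, mul_assoc]⟩
  -- If the least point of N x ∪ N y belongs to both sets, both x and y select it. Disagreement puts
  -- it in the symmetric difference, with probability at most δ since the union has at least |E|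
  -- points.
  have hcut : ∀ z : Q × L,
      ((Finset.univ.filter fun σ => a σ z.1 ≠ a σ (z.1 * f (ι z.2))).card : ℝ) ≤ δ * M := by
    rintro ⟨x, s⟩
    set y := x * f (ι s)
    have h1 := card_mul_card_orders_min (N x ∪ N y) (symmDiff (N x) (N y))
      (by rw [symmDiff_def]; exact sup_le_sup sdiff_le sdiff_le)
    have h2 : (Finset.univ.filter fun σ => a σ x ≠ a σ y) ⊆
        Finset.univ.filter fun σ : Q ≃ Fin (Fintype.card Q) =>
          ∃ u ∈ symmDiff (N x) (N y), ∀ v ∈ N x ∪ N y, σ u ≤ σ v := by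
      intro σ hσ
      simp only [Finset.mem_filter, Finset.mem_univ, true_and] at hσ ⊢
      obtain ⟨u, hu, hmin⟩ := (N x ∪ N y).exists_min_image σ
        ((hN x).mono Finset.subset_union_left)
      refine ⟨u, ?_, hmin⟩
      have hux : u ∈ N x → u = a σ x := fun h => σ.injective (le_antisymm
        (hmin _ (Finset.mem_union_left _ (haN σ x))) (hamin σ x u h))
      have huy : u ∈ N y → u = a σ y := fun h => σ.injective (le_antisymm
        (hmin _ (Finset.mem_union_right _ (haN σ y))) (hamin σ y u h))
      rw [Finset.mem_symmDiff]
      by_cases h3 : u ∈ N x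
      · exact Or.inl ⟨h3, fun h4 => hσ ((hux h3).symm.trans (huy h4))⟩
      · exact Or.inr ⟨(Finset.mem_union.1 hu).resolve_left h3, h3⟩
    have h3 := Finset.card_le_card h2
    have h4 : E.card ≤ (N x ∪ N y).card := by
      rw [← hNcard x]
      exact Finset.card_le_card Finset.subset_union_left
    have h5 : E.card * (Finset.univ.filter fun σ => a σ x ≠ a σ y).card ≤
        (symmDiff (E.image fun y => ι s * y) E).card * M :=
      (Nat.mul_le_mul h4 h3).trans (h1.trans (Nat.mul_le_mul_right _ (hsymm x s)))
    have h6 : (E.card : ℝ) * (Finset.univ.filter fun σ => a σ x ≠ a σ y).card ≤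
        (symmDiff (E.image fun y => ι s * y) E).card * M := by exact_mod_cast h5
    refine le_of_mul_le_mul_left (h6.trans ?_) hEpos
    calc _ ≤ δ * E.card * M := mul_le_mul_of_nonneg_right (hδ s) (Nat.cast_nonneg _)
      _ = _ := by ring
  have hdouble := Finset.sum_card_bipartiteAbove_eq_sum_card_bipartiteBelow
    (s := (Finset.univ : Finset (Q ≃ Fin (Fintype.card Q)))) (t := (Finset.univ : Finset (Q × L)))
    (fun σ z => a σ z.1 ≠ a σ (z.1 * f (ι z.2)))
  simp only [Finset.bipartiteAbove, Finset.bipartiteBelow] at hdouble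
  have hsum : ∑ σ : Q ≃ Fin (Fintype.card Q),
      ((Finset.univ.filter fun z : Q × L => a σ z.1 ≠ a σ (z.1 * f (ι z.2))).card : ℝ) ≤
      ∑ _σ : Q ≃ Fin (Fintype.card Q), δ * (Fintype.card Q * Fintype.card L) := by
    rw [← Nat.cast_sum, hdouble, Nat.cast_sum]
    refine (Finset.sum_le_sum fun z _ => hcut z).trans (le_of_eq ?_)
    simp only [Finset.sum_const, Finset.card_univ, Fintype.card_prod, nsmul_eq_mul, M]
    push_cast
    ring
  -- Some order cuts no more edges than the average.
  obtain ⟨σ, -, hσ⟩ := Finset.exists_le_of_sum_le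
    (Finset.univ_nonempty_iff.2 ⟨Fintype.equivFin Q⟩) hsum
  refine ⟨a σ, fun y => ?_, hσ⟩
  refine (Finset.card_le_card (t := E.image fun e => y * (f e)⁻¹) fun x hx => ?_).trans
    Finset.card_image_le
  simp only [Finset.mem_filter, Finset.mem_univ, true_and] at hx
  obtain ⟨e, he, h⟩ := Finset.mem_image.1 (haN σ x)
  exact Finset.mem_image.2 ⟨e, he, by rw [← hx, ← h, mul_inv_cancel_right]⟩

end RandomOrder

/-! ### Hyperfiniteness -/

section Hyperfinite

/-- Components are contained in the cells of a partition after deletion of the cut edges. -/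
theorem SimpleGraph.eq_of_reachable_deleteEdges {V X : Type*} {G : SimpleGraph V} (c : V → X)
    {E : Set (Sym2 V)} (hE : ∀ x y, G.Adj x y → c x ≠ c y → s(x, y) ∈ E) {x y : V}
    (h : (G.deleteEdges E).Reachable x y) : c x = c y := by
  obtain ⟨w⟩ := h
  induction w with
  | nil => rfl
  | cons hadj _ ih =>
    rw [← ih]
    by_contra hne
    rw [SimpleGraph.deleteEdges_adj] at hadj
    exact hadj.2 (hE _ _ hadj.1 hne)

theorem SimpleGraph.encard_supp_deleteEdges_le {V X : Type*} {G : SimpleGraph V} (c : V → X)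
    {E : Set (Sym2 V)} (hE : ∀ x y, G.Adj x y → c x ≠ c y → s(x, y) ∈ E) {K : ℕ}
    (hK : ∀ i, {x | c x = i}.encard ≤ K) (C : (G.deleteEdges E).ConnectedComponent) :
    C.supp.encard ≤ K := by
  induction C using SimpleGraph.ConnectedComponent.ind with
  | _ v =>
    refine (Set.encard_le_encard fun x hx => ?_).trans (hK (c v))
    exact SimpleGraph.eq_of_reachable_deleteEdges c hE
      (SimpleGraph.ConnectedComponent.exact (SimpleGraph.ConnectedComponent.mem_supp_iff _ _ |>.1 hx))

/-- To check hyperfiniteness it suffices to find, for almost all `n`, partitions into cells of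
bounded size which cut at most `ε |V n|` edges. -/
theorem isHyperfinite_of_cells {L : Type*} {V : ℕ → Type*} {G : ∀ n, LabelledGraph L (V n)}
    (hG : IsGraphSequence G)
    (h : ∀ ε : ℝ, 0 < ε → ∃ K : ℕ, ∀ᶠ n in atTop, ∃ (X : Type u) (c : V n → X),
      (∀ i, {x | c x = i}.encard ≤ K) ∧
      ({e ∈ (G n).toSimpleGraph.edgeSet | ∃ x y, e = s(x, y) ∧ c x ≠ c y}.ncard : ℝ) ≤
        ε * Nat.card (V n)) : IsHyperfinite G := by
  intro ε hε
  set η := min ε 1 / 2 with hη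
  have hη0 : 0 < η := by positivity
  have hηε : η < ε := by
    have := min_le_left ε 1
    rw [hη]; linarith
  have hη1 : η ≤ 1 / 2 := by
    have := min_le_right ε 1
    rw [hη]; linarith
  obtain ⟨K, hK⟩ := h η hη0
  obtain ⟨n₀, hn₀⟩ := eventually_atTop.1 (hK.and (hG.tendsto_card.eventually_ge_atTop 2))
  have hfin := hG.finite
  set K' := K + (∑ n ∈ Finset.range n₀, Nat.card (V n)) + 1 with hK'
  have hcard : Tendsto (fun n => (Nat.card (V n) : ℝ)) atTop atTop :=
    tendsto_natCast_atTop_atTop.comp hG.tendsto_card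
  -- The definition demands a genuine limit, so the cut sets are enlarged to exactly ⌊η|V n|⌋ edges,
  -- giving limit η. The first n₀ graphs lose no edges, their sizes being absorbed in K'.
  have key : ∀ n, ∃ E : Set (Sym2 (V n)), E ⊆ (G n).toSimpleGraph.edgeSet ∧
      (n₀ ≤ n → E.ncard = ⌊η * Nat.card (V n)⌋₊) ∧
      ∀ C : ((G n).toSimpleGraph.deleteEdges E).ConnectedComponent, C.supp.encard ≤ K' := by
    intro n
    rcases lt_or_ge n n₀ with hn | hn
    · refine ⟨∅, Set.empty_subset _, fun h' => absurd hn (not_lt.2 h'), fun C => ?_⟩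
      rw [← (Set.toFinite C.supp).cast_ncard_eq]
      refine Nat.cast_le.2 ?_
      have h1 : C.supp.ncard ≤ Nat.card (V n) := by
        rw [← Set.ncard_univ]
        exact Set.ncard_le_ncard (Set.subset_univ _)
      have h2 : Nat.card (V n) ≤ ∑ n ∈ Finset.range n₀, Nat.card (V n) :=
        Finset.single_le_sum (f := fun n => Nat.card (V n)) (fun _ _ => Nat.zero_le _)
          (Finset.mem_range.2 hn)
      omega
    · obtain ⟨⟨X, c, hc, hcut⟩, h2⟩ := hn₀ n hn
      set C := {e ∈ (G n).toSimpleGraph.edgeSet | ∃ x y, e = s(x, y) ∧ c x ≠ c y}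
      have hC : C ⊆ (G n).toSimpleGraph.edgeSet := fun e he => he.1
      have h3 : C.ncard ≤ ⌊η * Nat.card (V n)⌋₊ := Nat.le_floor hcut
      -- A connected graph has at least |V| - 1 edges, which is at least |V|/2 as |V| ≥ 2; this is
      -- the reason for η ≤ 1/2.
      have h4 : ⌊η * Nat.card (V n)⌋₊ ≤ (G n).toSimpleGraph.edgeSet.ncard := by
        have h5 := (hG.connected n).card_vert_le_card_edgeSet_add_one
        rw [Nat.card_coe_set_eq] at h5
        have h6 : (⌊η * Nat.card (V n)⌋₊ : ℝ) ≤ η * Nat.card (V n) :=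
          Nat.floor_le (by positivity)
        have h7 : η * Nat.card (V n) ≤ 1 / 2 * Nat.card (V n) :=
          mul_le_mul_of_nonneg_right hη1 (Nat.cast_nonneg _)
        have h8 : (2 : ℝ) * (⌊η * Nat.card (V n)⌋₊ : ℝ) ≤ Nat.card (V n) := by linarith
        have h9 : 2 * ⌊η * Nat.card (V n)⌋₊ ≤ Nat.card (V n) := by exact_mod_cast h8
        omega
      obtain ⟨E, hCE, hE, hEc⟩ := Set.exists_subsuperset_card_eq hC h3 h4
      refine ⟨E, hE, fun _ => hEc, fun D => ?_⟩
      refine (SimpleGraph.encard_supp_deleteEdges_le c (fun x y hxy hne =>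
        hCE ⟨hxy, x, y, rfl, hne⟩) hc D).trans (Nat.cast_le.2 ?_)
      omega
  choose E hE hEc hEK using key
  refine ⟨K', Nat.succ_pos _, E, hE, ⟨η, hηε, ?_⟩, hEK⟩
  refine ((tendsto_nat_floor_mul_div_atTop hη0.le).comp hcard).congr' ?_
  filter_upwards [eventually_ge_atTop n₀] with n hn
  rw [hEc n hn]
  rfl

end Hyperfinite

section Hyperfinite

open Classical in
theorem isHyperfinite_glue {L Γ : Type*} [Fintype L] [Group Γ]
    {N : ℕ → FiniteIndexNormalSubgroup Γ} {ι : L → Γ}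
    (hι : Subgroup.closure (Set.range ι) = ⊤) (hΓ : IsAmenableGroup Γ)
    (hN : IsGroupFiltration N) {W : ℕ → Type*} {H : ∀ n, LabelledGraph L (W n)}
    (hH : IsGraphSequence H) {k : ℕ → ℕ}
    (hk : ∀ n : ℕ, (Nat.card (W n) : ℝ) / (Nat.card (Γ ⧸ (N (k n)).toSubgroup) : ℝ) <
      1 / ((n : ℝ) + 1))
    (hkt : Tendsto k atTop atTop)
    (p : ∀ n, Γ ⧸ (N (k n)).toSubgroup) (q : ∀ n, W n) :
    IsHyperfinite fun n => (LabelledGraph.cayley fun s =>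
      QuotientGroup.mk' (N (k n)).toSubgroup (ι s)).glue (H n) (p n) (q n) := by
  refine isHyperfinite_of_cells (isGraphSequence_glue (fun n => LabelledGraph.cayley_connected _
    (QuotientGroup.mk'_surjective _) hι)
    (fun n => LabelledGraph.cayley_encard_neighborSet_le _) hH p q) fun ε hε => ?_
  obtain ⟨d, hd⟩ := hH.bounded_degree
  set l := Fintype.card L
  -- Half of ε pays for the cut edges of the quotient, over all l labels; the other half pays for
  -- every edge of the expander.
  set δ := ε / (2 * ((l : ℝ) + 1)) with hδ
  have hδ0 : 0 < δ := by positivity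
  obtain ⟨E, hE, hEδ⟩ := hΓ (Finset.univ.image ι) δ hδ0
  have hsmall : ∀ᶠ n : ℕ in atTop, (d : ℝ) * (1 / ((n : ℝ) + 1)) < ε / 2 := by
    have := (tendsto_one_div_add_atTop_nhds_zero_nat (𝕜 := ℝ)).const_mul (d : ℝ)
    rw [mul_zero] at this
    exact this.eventually_lt_const (half_pos hε)
  refine ⟨E.card, ?_⟩
  filter_upwards [hkt.eventually (hN.eventually_injOn E), hsmall] with n hinj hsm
  set Q := Γ ⧸ (N (k n)).toSubgroup
  set f := QuotientGroup.mk' (N (k n)).toSubgroup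
  have hWfin := hH.finite n
  have := Fintype.ofFinite Q
  have := Fintype.ofFinite (W n)
  obtain ⟨a, ha, hcut⟩ := exists_cells f ι E hE hinj
    (fun s => hEδ (ι s) (Finset.mem_image_of_mem _ (Finset.mem_univ s)))
  -- The cells are those of the quotient together with singletons in the expander.
  refine ⟨Q ⊕ {w : W n // w ≠ q n}, Sum.map a id, ?_, ?_⟩
  · rintro (y | w)
    · have h1 : {x : Q ⊕ {w : W n // w ≠ q n} | Sum.map a id x = Sum.inl y} ⊆
          Sum.inl '' ((Finset.univ.filter fun x => a x = y : Finset Q) : Set Q) := by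
        rintro (x | x) hx
        · exact ⟨x, by simpa using hx, rfl⟩
        · simp at hx
      refine (Set.encard_le_encard h1).trans ?_
      rw [Sum.inl_injective.encard_image, Set.encard_coe_eq_coe_finsetCard]
      exact Nat.cast_le.2 (by convert ha y)
    · have h1 : {x : Q ⊕ {w : W n // w ≠ q n} | Sum.map a id x = Sum.inr w} ⊆
          {Sum.inr w} := by
        rintro (x | x) hx
        · simp at hx
        · simpa using hx
      refine (Set.encard_le_encard h1).trans ?_
      rw [Set.encard_singleton]
      exact_mod_cast hE.card_pos
  · set Z := Finset.univ.filter fun z : Q × L => a z.1 ≠ a (z.1 * f (ι z.2)) with hZ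
    replace hcut : (Z.card : ℝ) ≤ δ * (Fintype.card Q * l) := by convert hcut
    set P := {z : W n × W n | (H n).toSimpleGraph.Adj z.1 z.2}
    have hsub : {e ∈ ((LabelledGraph.cayley fun s => f (ι s)).glue (H n) (p n)
        (q n)).toSimpleGraph.edgeSet | ∃ x y, e = s(x, y) ∧ Sum.map a id x ≠ Sum.map a id y} ⊆
        ((fun z : Q × L => s(Sum.inl z.1, Sum.inl (z.1 * f (ι z.2)))) '' (Z : Set (Q × L))) ∪
        ((fun z : W n × W n => s(LabelledGraph.wedgeRight (p n) (q n) z.1,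
          LabelledGraph.wedgeRight (p n) (q n) z.2)) '' P) := by
      rintro e ⟨he, x, y, rfl, hne⟩
      rw [SimpleGraph.mem_edgeSet, LabelledGraph.glue_adj] at he
      rcases he with ⟨x, y, h, rfl, rfl⟩ | ⟨x, y, h, rfl, rfl⟩
      · left
        have hne' : a x ≠ a y := fun h => hne (by simp [h])
        rcases (LabelledGraph.cayley_adj.1 h).2 with ⟨s, rfl⟩ | ⟨s, rfl⟩
        · exact ⟨(x, s), by simpa [hZ] using hne', rfl⟩
        · exact ⟨(y, s), by simpa [hZ] using hne'.symm, Sym2.eq_swap⟩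
      · right
        exact ⟨(x, y), h, rfl⟩
    have h1 := (Set.ncard_le_ncard hsub (Set.toFinite _)).trans
      ((Set.ncard_union_le _ _).trans (add_le_add (Set.ncard_image_le (Set.toFinite _))
        (Set.ncard_image_le (Set.toFinite _))))
    have h2 : P.ncard ≤ d * Fintype.card (W n) := SimpleGraph.card_adj_pairs_le (hd n)
    rw [Set.ncard_coe_finset] at h1
    have h3 := (Nat.cast_le (α := ℝ)).2 (h1.trans (Nat.add_le_add_left h2 _))
    refine h3.trans ?_
    have h4 := LabelledGraph.card_glue (V := Q) (q n)
    have h5 := hk n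
    have hw : 0 < Nat.card (W n) := Nat.card_pos_iff.2 ⟨⟨q n⟩, inferInstance⟩
    have hQ : 0 < Nat.card Q := (N (k n)).card_quotient_pos
    rw [← Nat.card_eq_fintype_card] at hcut ⊢
    generalize Nat.card (Q ⊕ {w : W n // w ≠ q n}) = v at h4 ⊢
    change (Nat.card (W n) : ℝ) / (Nat.card Q : ℝ) < _ at h5
    generalize Nat.card Q = m at h4 h5 hQ hcut
    generalize Nat.card (W n) = w at h4 h5 hw
    have hQ' : (0 : ℝ) < m := by exact_mod_cast hQ
    have hv : (m : ℝ) ≤ v := by exact_mod_cast (by omega : m ≤ v)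
    have h6 : (w : ℝ) ≤ 1 / ((n : ℝ) + 1) * m := ((div_lt_iff₀ hQ').1 h5).le
    have h7 : δ * (m * l) ≤ ε / 2 * m := by
      have : δ * l ≤ ε / 2 := by
        rw [hδ, div_mul_eq_mul_div, div_le_div_iff₀ (by positivity) two_pos]
        nlinarith
      nlinarith
    have h8 : (d : ℝ) * w ≤ ε / 2 * m :=
      calc (d : ℝ) * w ≤ d * (1 / ((n : ℝ) + 1) * m) :=
            mul_le_mul_of_nonneg_left h6 (Nat.cast_nonneg _)
        _ = d * (1 / ((n : ℝ) + 1)) * m := by ring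
        _ ≤ _ := mul_le_mul_of_nonneg_right hsm.le hQ'.le
    push_cast
    calc (Z.card : ℝ) + d * w ≤ ε / 2 * m + ε / 2 * m := add_le_add (hcut.trans h7) h8
      _ = ε * m := by ring
      _ ≤ ε * v := mul_le_mul_of_nonneg_left hv hε.le

end Hyperfinite

/-! ### Expanders obstruct property A -/

section PropertyA

theorem lp.hasSum_abs_norm_one {α : Type*} (f : lp (fun _ : α => ℝ) 1) :
    HasSum (fun z => |f z|) ‖f‖ := by
  simpa using lp.hasSum_norm (p := 1) (by simp) f

theorem unionGraph_encard_neighborSet_le {L : Type*} {V : ℕ → Type*}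
    {G : ∀ n, LabelledGraph L (V n)} {d : ℕ}
    (hd : ∀ n x, ((G n).toSimpleGraph.neighborSet x).encard ≤ d) (a : Σ n, V n) :
    ((unionGraph G).neighborSet a).encard ≤ d := by
  obtain ⟨n, x⟩ := a
  have hsub : (unionGraph G).neighborSet ⟨n, x⟩ ⊆
      Sigma.mk n '' (G n).toSimpleGraph.neighborSet x := by
    rintro b ⟨m, x', y, h, hx, rfl⟩
    cases hx
    exact ⟨y, h, rfl⟩
  refine (Set.encard_le_encard hsub).trans ?_
  rw [sigma_mk_injective.encard_image]
  exact hd n x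

open Classical in
/-- A graph sequence of bounded degree which contains an expander does not have property A. -/
theorem not_hasPropertyA_of_isExpander {L L' : Type*} {V W : ℕ → Type*}
    {G : ∀ n, LabelledGraph L (V n)} {H : ∀ n, LabelledGraph L' (W n)} (hG : IsGraphSequence G)
    (hH : IsExpander H) (j : ∀ n, W n → V n) (hj : ∀ n, Function.Injective (j n))
    (hadj : ∀ n x y, (H n).toSimpleGraph.Adj x y → (G n).toSimpleGraph.Adj (j n x) (j n y)) :
    ¬ HasPropertyA G := by
  intro hA
  obtain ⟨hH, c, hc, hch⟩ := hH
  obtain ⟨d, hd⟩ := hH.bounded_degree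
  obtain ⟨e, he⟩ := hG.bounded_degree
  -- There are at most d|W n| ordered adjacent pairs, and d·c/(d + 1) < c. With R now fixed, n is
  -- taken so large that an R-ball contains at most half of W n.
  obtain ⟨R, -, ξ, hξ1, hξR, hξε⟩ := hA (c / ((d : ℝ) + 1)) (by positivity)
  obtain ⟨n, hn, hn1⟩ := ((hH.tendsto_card.eventually_ge_atTop (2 * (e + 1) ^ R)).and
    (hH.tendsto_card.eventually_ge_atTop 1)).exists
  have := hH.finite n
  have := Fintype.ofFinite (W n)
  rw [Nat.card_eq_fintype_card] at hn hn1
  let i : W n → Σ n, V n := fun x => ⟨n, j n x⟩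
  have hi : Function.Injective i := fun x y h => hj n (sigma_mk_injective h)
  have hpt : ∀ z, c * ∑ x, |ξ (i x) z| ≤
      ∑ p : W n × W n with (H n).toSimpleGraph.Adj p.1 p.2, |(ξ (i p.1) - ξ (i p.2)) z| := by
    intro z
    refine (SimpleGraph.mul_sum_le_sum_adj_abs_sub (G := (H n).toSimpleGraph)
      (mul_card_le_of_lt_cheegerConstant (hch n)) (fun x => |ξ (i x) z|)
      (fun _ => abs_nonneg _) ?_).trans (Finset.sum_le_sum fun p _ => ?_)
    · obtain ⟨t, ht, htc⟩ := SimpleGraph.exists_finset_ball_subset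
        (unionGraph_encard_neighborSet_le he) z R
      refine le_trans (Nat.mul_le_mul_left 2 (le_trans ?_ htc)) hn
      refine Finset.card_le_card_of_injOn i (fun x hx => ht _ ?_) hi.injOn
      rw [SimpleGraph.edist_comm]
      exact hξR _ _ (by simpa using hx)
    · exact abs_abs_sub_abs_le_abs_sub _ _
  -- Summing the pointwise inequality over z turns the left side into c|W n| and the right side into
  -- a sum of ℓ¹-distances over adjacent pairs.
  have hs1 : HasSum (fun z => c * ∑ x, |ξ (i x) z|) (c * Fintype.card (W n)) := by
    have := (hasSum_sum (s := Finset.univ) fun x _ => lp.hasSum_abs_norm_one (ξ (i x))).mul_left c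
    simpa [hξ1] using this
  have hs2 := hasSum_sum (s := Finset.univ.filter fun p : W n × W n =>
    (H n).toSimpleGraph.Adj p.1 p.2) fun p _ => lp.hasSum_abs_norm_one (ξ (i p.1) - ξ (i p.2))
  have h1 := hasSum_le hpt hs1 hs2
  have h2 : ∑ p : W n × W n with (H n).toSimpleGraph.Adj p.1 p.2, ‖ξ (i p.1) - ξ (i p.2)‖ ≤
      (d * Fintype.card (W n)) * (c / ((d : ℝ) + 1)) := by
    refine (Finset.sum_le_card_nsmul _ _ (c / ((d : ℝ) + 1)) fun p hp => ?_).trans ?_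
    · exact (hξε _ _ ⟨n, _, _, hadj n _ _ (by simpa using hp), rfl, rfl⟩).le
    · rw [nsmul_eq_mul]
      refine mul_le_mul_of_nonneg_right ?_ (by positivity)
      have := SimpleGraph.card_adj_pairs_le (hd n)
      rw [show {p : W n × W n | (H n).toSimpleGraph.Adj p.1 p.2} =
        ((Finset.univ.filter fun p : W n × W n => (H n).toSimpleGraph.Adj p.1 p.2 :
          Finset (W n × W n)) : Set (W n × W n)) by ext; simp, Set.ncard_coe_finset] at this
      exact_mod_cast this
  have hW : (1 : ℝ) ≤ Fintype.card (W n) := by exact_mod_cast hn1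
  have h3 := h1.trans h2
  rw [← mul_div_assoc, le_div_iff₀ (by positivity)] at h3
  nlinarith [mul_pos hc (lt_of_lt_of_le one_pos hW)]

end PropertyA

/-! ### The integers as an example -/

section Integers

/-- The filtration of the integers by the subgroups `2 ^ k ℤ`. -/
def twoPowFiltration (k : ℕ) : FiniteIndexNormalSubgroup (Multiplicative ℤ) :=
  FiniteIndexNormalSubgroup.ofSubgroup
    (AddMonoidHom.toMultiplicative (Int.castAddHom (ZMod (2 ^ k)))).ker

theorem mem_twoPowFiltration {k : ℕ} {g : Multiplicative ℤ} :
    g ∈ (twoPowFiltration k).toSubgroup ↔ (2 : ℤ) ^ k ∣ g.toAdd := by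
  have h : g ∈ (twoPowFiltration k).toSubgroup ↔ ((g.toAdd : ℤ) : ZMod (2 ^ k)) = 0 := by
    rw [twoPowFiltration, FiniteIndexNormalSubgroup.toSubgroup_ofSubgroup, MonoidHom.mem_ker]
    rfl
  rw [h, ZMod.intCast_zmod_eq_zero_iff_dvd]
  push_cast
  rfl

theorem isGroupFiltration_twoPowFiltration : IsGroupFiltration twoPowFiltration := by
  refine ⟨fun i j hij g hg => ?_, ?_⟩
  · exact mem_twoPowFiltration.2 ((pow_dvd_pow 2 hij).trans (mem_twoPowFiltration.1 hg))
  · rw [eq_bot_iff]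
    intro g hg
    rw [Subgroup.mem_iInf] at hg
    rw [Subgroup.mem_bot]
    -- Divisibility of g by 2^|g| forces g = 0, because |g| < 2^|g|.
    refine Multiplicative.toAdd.injective (Int.eq_zero_of_abs_lt_dvd
      (mem_twoPowFiltration.1 (hg g.toAdd.natAbs)) ?_)
    rw [Int.abs_eq_natAbs]
    exact_mod_cast Nat.lt_two_pow_self

/-- A shift by at most M alters the interval [0, m) only within distance M of its ends, that is in
at most 4M points. -/
theorem isAmenableGroup_int : IsAmenableGroup (Multiplicative ℤ) := by
  classical
  intro K ε hε
  set M := K.sup fun g => g.toAdd.natAbs with hM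
  obtain ⟨m, hm⟩ := exists_nat_gt (4 * (M : ℝ) / ε)
  have hm0 : 0 < m := by
    have : (0 : ℝ) < m := lt_of_le_of_lt (by positivity) hm
    exact_mod_cast this
  refine ⟨(Finset.Ico (0 : ℤ) m).image Multiplicative.ofAdd,
    (Finset.nonempty_Ico.2 (by exact_mod_cast hm0)).image _, fun g hg => ?_⟩
  have hgM : g.toAdd.natAbs ≤ M := Finset.le_sup (f := fun g => g.toAdd.natAbs) hg
  rw [Finset.card_image_of_injective _ Multiplicative.ofAdd.injective, Int.card_Ico]
  have hsub : symmDiff (((Finset.Ico (0 : ℤ) m).image Multiplicative.ofAdd).image fun x => g * x)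
      ((Finset.Ico (0 : ℤ) m).image Multiplicative.ofAdd) ⊆
      (Finset.Ico (-(M : ℤ)) M ∪ Finset.Ico (m - M : ℤ) (m + M)).image Multiplicative.ofAdd := by
    intro y hy
    have hmem : ∀ y, y ∈ (Finset.Ico (0 : ℤ) m).image Multiplicative.ofAdd ↔
        0 ≤ y.toAdd ∧ y.toAdd < m := fun y => by
      constructor
      · intro h
        obtain ⟨z, hz, rfl⟩ := Finset.mem_image.1 h
        exact Finset.mem_Ico.1 hz
      · exact fun h => Finset.mem_image.2 ⟨y.toAdd, Finset.mem_Ico.2 h, rfl⟩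
    have hmem' : y ∈ ((Finset.Ico (0 : ℤ) m).image Multiplicative.ofAdd).image
        (fun x => g * x) ↔ 0 ≤ y.toAdd - g.toAdd ∧ y.toAdd - g.toAdd < m := by
      constructor
      · intro h
        obtain ⟨z, hz, rfl⟩ := Finset.mem_image.1 h
        simpa using (hmem z).1 hz
      · exact fun h => Finset.mem_image.2 ⟨g⁻¹ * y, (hmem _).2
          (by simpa [sub_eq_neg_add] using h), by simp⟩
    rw [Finset.mem_symmDiff, hmem, hmem'] at hy
    refine Finset.mem_image.2 ⟨y.toAdd, ?_, rfl⟩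
    rw [Finset.mem_union, Finset.mem_Ico, Finset.mem_Ico]
    omega
  have hcard : (symmDiff (((Finset.Ico (0 : ℤ) m).image Multiplicative.ofAdd).image
      fun x => g * x) ((Finset.Ico (0 : ℤ) m).image Multiplicative.ofAdd)).card ≤ 4 * M := by
    refine (Finset.card_le_card hsub).trans
      (Finset.card_image_le.trans ((Finset.card_union_le _ _).trans ?_))
    rw [Int.card_Ico, Int.card_Ico]
    omega
  rw [div_lt_iff₀ hε] at hm
  simp only [sub_zero, Int.toNat_natCast]
  refine (Nat.cast_le.2 (le_trans (le_of_eq ?_) hcard)).trans ?_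
  · congr!
  · push_cast
    linarith

theorem closure_ofAdd_one :
    Subgroup.closure (({Multiplicative.ofAdd 1} : Finset (Multiplicative ℤ)) :
      Set (Multiplicative ℤ)) = ⊤ := by
  rw [Finset.coe_singleton, eq_top_iff]
  intro g _
  rw [Subgroup.mem_closure_singleton]
  refine ⟨g.toAdd, ?_⟩
  rw [← ofAdd_zsmul]
  simp

end Integers

/-! ### Assembling the construction -/

section Construction

variable {Γ : Type u} [Group Γ] {S : Finset Γ} {N : ℕ → FiniteIndexNormalSubgroup Γ}

/-- Without labels there would be no edges, hence no labelled expander. -/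
theorem nonempty_of_closure_eq_top [Infinite Γ] (hS : Subgroup.closure (S : Set Γ) = ⊤) : Nonempty S := by
  by_contra h
  rw [nonempty_subtype, not_exists] at h
  have : S = ∅ := Finset.eq_empty_of_forall_notMem h
  rw [this, Finset.coe_empty, Subgroup.closure_empty] at hS
  exact bot_ne_top hS

theorem IsGroupFiltration.exists_card_div_card_lt [Infinite Γ] (hN : IsGroupFiltration N) (w n : ℕ) :
    ∃ k, (w : ℝ) / (Nat.card (Γ ⧸ (N k).toSubgroup) : ℝ) < 1 / ((n : ℝ) + 1) := by
  obtain ⟨k, hk⟩ := hN.exists_le_card_quotient (w * (n + 1) + 1)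
  refine ⟨k, ?_⟩
  have hpos : (0 : ℝ) < Nat.card (Γ ⧸ (N k).toSubgroup) := by
    exact_mod_cast (N k).card_quotient_pos
  rw [div_lt_div_iff₀ hpos (by positivity), one_mul]
  exact_mod_cast hk

/-- Gluing the members of an expander to much larger members of the box space of an amenable group
yields a hyperfinite sofic approximation without property A. -/
theorem glue_quotientCayley (hS : Subgroup.closure (S : Set Γ) = ⊤) (hΓ : IsAmenableGroup Γ)
    (hN : IsGroupFiltration N) {W : ℕ → Type v} {H : ∀ n, LabelledGraph S (W n)}
    (hH : IsExpander H) (k : ℕ → ℕ)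
    (hk : ∀ n : ℕ, (Nat.card (W n) : ℝ) / (Nat.card (Γ ⧸ (N (k n)).toSubgroup) : ℝ) <
      1 / ((n : ℝ) + 1))
    (p : ∀ n, Γ ⧸ (N (k n)).toSubgroup) (q : ∀ n, W n) :
    IsSoficApproximation (fun s : S => (s : Γ))
      (fun n => (quotientCayley S (N (k n))).glue (H n) (p n) (q n)) ∧
    IsHyperfinite (fun n => (quotientCayley S (N (k n))).glue (H n) (p n) (q n)) ∧
    ¬ HasPropertyA (fun n => (quotientCayley S (N (k n))).glue (H n) (p n) (q n)) := by
  have hι : Subgroup.closure (Set.range fun s : S => (s : Γ)) = ⊤ := by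
    rw [← hS]
    congr 1
    exact Subtype.range_coe
  -- The size condition, with W n nonempty, forces the quotients to grow and thereby k(n) → ∞.
  have hkn : ∀ n, n + 1 ≤ Nat.card (Γ ⧸ (N (k n)).toSubgroup) := fun n => by
    have hfin := hH.1.finite n
    have hw : 0 < Nat.card (W n) := Nat.card_pos_iff.2 ⟨⟨q n⟩, inferInstance⟩
    have hw' : (1 : ℝ) ≤ Nat.card (W n) := by exact_mod_cast hw
    have hpos : (0 : ℝ) < Nat.card (Γ ⧸ (N (k n)).toSubgroup) := by
      exact_mod_cast (N (k n)).card_quotient_pos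
    have h := hk n
    rw [div_lt_div_iff₀ hpos (by positivity), one_mul] at h
    have h' : (n : ℝ) + 1 ≤ Nat.card (Γ ⧸ (N (k n)).toSubgroup) := by nlinarith
    exact_mod_cast h'
  have hkt := hN.tendsto_atTop_of_card fun n => (Nat.le_succ n).trans (hkn n)
  have hsofic := isSoficApproximation_glue hι hN hH.1 hk hkt hkn p q
  exact ⟨hsofic, isHyperfinite_glue hι hΓ hN hH.1 hk hkt p q,
    not_hasPropertyA_of_isExpander hsofic.1 hH
      (fun n => LabelledGraph.wedgeRight (p n) (q n))
      (fun n => LabelledGraph.wedgeRight_injective)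
      fun n x y h => LabelledGraph.glue_adj.2 (Or.inr ⟨x, y, h, rfl, rfl⟩)⟩

theorem IsGroupFiltration.residuallyFinite (hN : IsGroupFiltration N) :
    Group.ResiduallyFinite Γ where
  iInf_eq_bot := eq_bot_iff.2 (hN.2 ▸ le_iInf fun k => iInf_le _ (N k))

/-- A single witness refutes both implications, the integers being amenable and residually finite.
-/
theorem exists_sofic_hyperfinite_not_hasPropertyA :
    ∃ (V : ℕ → Type) (G : ∀ n, LabelledGraph
        ({Multiplicative.ofAdd 1} : Finset (Multiplicative ℤ)) (V n)),
      IsSoficApproximation (fun s : ({Multiplicative.ofAdd 1} : Finset (Multiplicative ℤ)) =>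
        (s : Multiplicative ℤ)) G ∧ IsHyperfinite G ∧ ¬ HasPropertyA G := by
  have := nonempty_of_closure_eq_top closure_ofAdd_one
  obtain ⟨W, H, hH⟩ :=
    exists_isExpander ({Multiplicative.ofAdd 1} : Finset (Multiplicative ℤ))
  choose k hk using fun n =>
    isGroupFiltration_twoPowFiltration.exists_card_div_card_lt (Nat.card (W n)) n
  exact ⟨_, _, glue_quotientCayley closure_ofAdd_one isAmenableGroup_int
    isGroupFiltration_twoPowFiltration hH k hk (fun _ => 1)
    fun n => (hH.1.connected n).nonempty.some⟩

end Construction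

theorem mainTheorem9 :
    -- the construction, for an arbitrary group, filtration and labelled expander
    (∀ (Γ : Type u) [Group Γ] [Infinite Γ] (S : Finset Γ) (N : ℕ → FiniteIndexNormalSubgroup Γ),
      Subgroup.closure (S : Set Γ) = ⊤ → IsAmenableGroup Γ → IsGroupFiltration N →
      (∃ (W : ℕ → Type) (H : ∀ n, LabelledGraph S (W n)), IsExpander H) ∧
      ∀ (W : ℕ → Type v) (H : ∀ n, LabelledGraph S (W n)), IsExpander H →
        (∀ n : ℕ, ∃ k : ℕ,
          (Nat.card (W n) : ℝ) / (Nat.card (Γ ⧸ (N k).toSubgroup) : ℝ) < 1 / ((n : ℝ) + 1)) ∧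
        ∀ k : ℕ → ℕ,
          (∀ n : ℕ, (Nat.card (W n) : ℝ) / (Nat.card (Γ ⧸ (N (k n)).toSubgroup) : ℝ) <
            1 / ((n : ℝ) + 1)) →
          ∀ (p : ∀ n, Γ ⧸ (N (k n)).toSubgroup) (q : ∀ n, W n),
            IsSoficApproximation (fun s : S => (s : Γ))
              (fun n => (quotientCayley S (N (k n))).glue (H n) (p n) (q n)) ∧
            IsHyperfinite (fun n => (quotientCayley S (N (k n))).glue (H n) (p n) (q n)) ∧
            ¬ HasPropertyA (fun n => (quotientCayley S (N (k n))).glue (H n) (p n) (q n))) ∧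
    -- the construction applies to some group
    (∃ (Γ : Type) (_ : Group Γ) (S : Finset Γ) (N : ℕ → FiniteIndexNormalSubgroup Γ),
      Infinite Γ ∧ Subgroup.closure (S : Set Γ) = ⊤ ∧ IsAmenableGroup Γ ∧ IsGroupFiltration N) ∧
    -- amenability of the group does not imply property A of a sofic approximation
    (¬ ∀ (Γ : Type) [Group Γ] [Group.ResiduallyFinite Γ] (S : Finset Γ) (V : ℕ → Type)
        (G : ∀ n, LabelledGraph S (V n)), Subgroup.closure (S : Set Γ) = ⊤ →
        IsSoficApproximation (fun s : S => (s : Γ)) G → IsAmenableGroup Γ → HasPropertyA G) ∧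
    -- hyperfiniteness of a sofic approximation does not imply property A
    (¬ ∀ (Γ : Type) [Group Γ] [Group.ResiduallyFinite Γ] (S : Finset Γ) (V : ℕ → Type)
        (G : ∀ n, LabelledGraph S (V n)), Subgroup.closure (S : Set Γ) = ⊤ →
        IsSoficApproximation (fun s : S => (s : Γ)) G → IsHyperfinite G → HasPropertyA G) := by
  refine ⟨fun Γ _ _ S N hS hΓ hN => ⟨?_, fun W H hH => ⟨fun n => hN.exists_card_div_card_lt _ n,
    fun k hk p q => glue_quotientCayley hS hΓ hN hH k hk p q⟩⟩, ?_, fun h => ?_, fun h => ?_⟩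
  · have := nonempty_of_closure_eq_top hS
    exact exists_isExpander S
  · exact ⟨Multiplicative ℤ, inferInstance, {Multiplicative.ofAdd 1}, twoPowFiltration,
      inferInstance, closure_ofAdd_one, isAmenableGroup_int, isGroupFiltration_twoPowFiltration⟩
  · obtain ⟨V, G, hG, -, hA⟩ := exists_sofic_hyperfinite_not_hasPropertyA
    have := isGroupFiltration_twoPowFiltration.residuallyFinite
    exact hA (h _ _ V G closure_ofAdd_one hG isAmenableGroup_int)
  · obtain ⟨V, G, hG, hhyp, hA⟩ := exists_sofic_hyperfinite_not_hasPropertyA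
    have := isGroupFiltration_twoPowFiltration.residuallyFinite
    exact hA (h _ _ V G closure_ofAdd_one hG hhyp)
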